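/- A symmetric monoidal closed (SMC) category is a symmetric monoidal category in which every functor $-\otimes b$ has a chosen right adjoint $b\multimap -$, with counit $\epsilon_{bc}\colon (b\multimap c)\otimes b\to c$ and unit $\eta_{ab}\colon a\to b\multimap(a\otimes b)$. A strict SMC functor is a functor preserving all of this structure ($I$, $\otimes$, $\multimap$ on objects and morphisms, and the associativity, unit, symmetry, $\epsilon$ and $\eta$ maps) on the nose. For a set $X$, the set $\overline X$ of SMC types is generated by $e ::= x \mid I\mid e\otimes e\mid e\multimap e$ with $x\in X$. An SMC signature $(X,\Sigma)$ consists of sets $X$, $\Sigma$ and functions $s,t\colon\Sigma\to\overline X$. Let $\mathcal D$ be an SMC category. An interpretation $G$ of $(X,\Sigma)$ (with no equations) in $\mathcal D$ consists of a function $G_X\colon X\to\mathrm{ob}\,\mathcal D$, with unique extension $\overline{G_X}\colon\overline X\to\mathrm{ob}\,\mathcal D$ commuting with the type constructors, and, for each $\alpha\in\Sigma$, of a morphism $G(\alpha)\colon\overline{G_X}(s(\alpha))\to\overline{G_X}(t(\alpha))$ of $\mathcal D$. Interpretations are carried along strict SMC functors $H\colon\mathcal D\to\mathcal D'$ by applying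 $H$. Let $\mathcal C_X$ be the free SMC category on $X$: its objects are the elements of $\overline X$, and its morphisms are the formal composites of identities, $\alpha_{abc}^{\pm1}$, $\lambda_a^{\pm1}$, $\rho_a^{\pm1}$, $\sigma_{ab}$, $\epsilon_{ab}$, $\eta_{ab}$ under $\circ$, $\otimes$ and $\multimap$, modulo the smallest congruence making them into an SMC category. For a list of elements of $\Sigma$ put $\mathrm{ty}()=I$, $\mathrm{ty}(\alpha)=s(\alpha)\multimap t(\alpha)$ and $\mathrm{ty}(\alpha_1,\dots,\alpha_n)=\mathrm{ty}(\alpha_1,\dots,\alpha_{n-1})\otimes\mathrm{ty}(\alpha_n)$ for $n\ge2$. Let $\mathcal C'_{X,\Sigma}$ be the category whose objects are those of $\mathcal C_X$ and whose morphisms $U\to V$ are the pairs $(\Gamma,\phi)$ of a list $\Gamma$ in $\Sigma$ and a morphism $\phi\colon\mathrm{ty}(\Gamma)\otimes U\to V$ of $\mathcal C_X$. The identity of $U$ is $((),\,I\otimes U\cong U)$. The composite of $(\Gamma,\phi)\colon U\to V$ and $(\Delta,\psi)\colon V\to W$ is $(\Delta+\Gamma,\xi)$, where $+$ is concatenation and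 $\xi$ is $$\mathrm{ty}(\Delta+\Gamma)\otimes U\cong\mathrm{ty}(\Delta)\otimes(\mathrm{ty}(\Gamma)\otimes U)\xrightarrow{\ \mathrm{ty}(\Delta)\otimes\phi\ }\mathrm{ty}(\Delta)\otimes V\xrightarrow{\ \psi\ }W .$$ Let $\sim$ be the congruence on $\mathcal C'_{X,\Sigma}$ generated by $(\sigma\Gamma,\phi)\sim(\Gamma,\phi\circ(\hat\sigma\otimes U))$, for $\sigma$ a permutation of the entries of $\Gamma$ and $\hat\sigma\colon\mathrm{ty}(\Gamma)\to\mathrm{ty}(\sigma\Gamma)$ the canonical map built from symmetries and from associativity and unit isomorphisms. Let $\mathcal C_{X,\Sigma}=\mathcal C'_{X,\Sigma}/{\sim}$. It is an SMC category as follows. * On objects, $I$, $\otimes$ and $\multimap$ are those of $\mathcal C_X$. * The tensor product of $(\Gamma,\phi)\colon U\to V$ and $(\Gamma',\phi')\colon U'\to V'$ is represented by $(\Gamma+\Gamma',\theta)$, where $\theta$ is $\mathrm{ty}(\Gamma+\Gamma')\otimes(U\otimes U')\cong(\mathrm{ty}(\Gamma)\otimes U)\otimes(\mathrm{ty}(\Gamma')\otimes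 U')\xrightarrow{\phi\otimes\phi'}V\otimes V'$. * The associativity, unit and symmetry maps are the images of those of $\mathcal C_X$ under $\phi\mapsto((),\ I\otimes U\cong U\xrightarrow{\phi}V)$. * The adjunction bijections are induced by those of $\mathcal C_X$, applied to the second components of the pairs. For $\alpha\in\Sigma$ let $[\alpha]\colon s(\alpha)\to t(\alpha)$ be the morphism of $\mathcal C_{X,\Sigma}$ represented by $((\alpha),\epsilon_{s(\alpha),t(\alpha)})$. **Theorem.** For every SMC signature $(X,\Sigma)$, the category $\mathcal C_{X,\Sigma}$ is the classifying category of the theory with signature $(X,\Sigma)$ and no equations. That is, for every SMC category $\mathcal D$, sending a strict SMC functor $F\colon\mathcal C_{X,\Sigma}\to\mathcal D$ to the interpretation $G$ with $G_X(x)=F(x)$ and $G(\alpha)=F[\alpha]\colon F(s(\alpha))\to F(t(\alpha))$ is a bijection from strict SMC functors $\mathcal C_{X,\Sigma}\to\mathcal D$ to interpretations of $(X,\Sigma)$ in $\mathcal D$. Moreover, this bijection is natural with respect to strict SMC functors $\mathcal D\to\mathcal D'$. -/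

import Mathlib

open CategoryTheory MonoidalCategory

universe u v₁ v₂ v₃ u₁ u₂ u₃

namespace SMC

/-- The internal hom `a ⊸ b`. -/
abbrev lolli {D : Type u₁} [Category.{v₁} D] [MonoidalCategory D] [MonoidalClosed D] (a b : D) : D :=
  (ihom a).obj b

section Closed

variable {D : Type u₁} [Category.{v₁} D] [MonoidalCategory D] [SymmetricCategory D]
  [MonoidalClosed D]

/-- The functorial action `f ⊸ g : (b ⊸ c) ⟶ (a ⊸ d)` of the internal hom, for `f : a ⟶ b` and
`g : c ⟶ d`. -/
def lolliMap {a b c d : D} (f : a ⟶ b) (g : c ⟶ d) : lolli b c ⟶ lolli a d :=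
  (MonoidalClosed.pre f).app c ≫ (ihom a).map g

/-- The counit `ε : (a ⊸ b) ⊗ a ⟶ b`. Mathlib's evaluation is `a ⊗ (a ⊸ b) ⟶ b`; here the internal
hom out of `a` is right adjoint to tensoring with `a` on the right. -/
def eval (a b : D) : lolli a b ⊗ a ⟶ b :=
  (β_ (lolli a b) a).hom ≫ (ihom.ev a).app b

/-- The unit `η : a ⟶ b ⊸ (a ⊗ b)`. -/
def coeval (a b : D) : a ⟶ lolli b (a ⊗ b) :=
  (ihom.coev b).app a ≫ (ihom b).map (β_ b a).hom

end Closed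

/-- A strict symmetric monoidal closed functor: a functor preserving all of the symmetric monoidal
closed structure on the nose. Equality of morphisms whose sources and targets are only
propositionally equal is expressed by heterogeneous equality. -/
@[ext]
structure StrictFunctor (C : Type u₁) [Category.{v₁} C] [MonoidalCategory C] [SymmetricCategory C]
    [MonoidalClosed C] (D : Type u₂) [Category.{v₂} D] [MonoidalCategory D] [SymmetricCategory D]
    [MonoidalClosed D] where
  functor : C ⥤ D
  obj_unit : functor.obj (𝟙_ C) = 𝟙_ D
  obj_tensor (a b : C) : functor.obj (a ⊗ b) = functor.obj a ⊗ functor.obj b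
  obj_lolli (a b : C) : functor.obj (lolli a b) = lolli (functor.obj a) (functor.obj b)
  map_tensor {a b c d : C} (f : a ⟶ b) (g : c ⟶ d) :
    HEq (functor.map (f ⊗ₘ g)) (functor.map f ⊗ₘ functor.map g)
  map_lolli {a b c d : C} (f : a ⟶ b) (g : c ⟶ d) :
    HEq (functor.map (lolliMap f g)) (lolliMap (functor.map f) (functor.map g))
  map_associator (a b c : C) : HEq (functor.map (α_ a b c).hom)
    (α_ (functor.obj a) (functor.obj b) (functor.obj c)).hom
  map_leftUnitor (a : C) : HEq (functor.map (λ_ a).hom) (λ_ (functor.obj a)).hom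
  map_rightUnitor (a : C) : HEq (functor.map (ρ_ a).hom) (ρ_ (functor.obj a)).hom
  map_braiding (a b : C) : HEq (functor.map (β_ a b).hom)
    (β_ (functor.obj a) (functor.obj b)).hom
  map_eval (a b : C) : HEq (functor.map (eval a b)) (eval (functor.obj a) (functor.obj b))
  map_coeval (a b : C) : HEq (functor.map (coeval a b)) (coeval (functor.obj a) (functor.obj b))

/-- The set of symmetric monoidal closed types over a set `X` of ground types. -/
inductive Ty (X : Type u) : Type u
  | var (x : X) : Ty X
  | unit : Ty X
  | tensor (a b : Ty X) : Ty X
  | lolli (a b : Ty X) : Ty X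

/-- The unique extension of a function from the ground types to the objects of `D` to a function on
all types commuting with the type constructors. -/
def Ty.interp {X : Type u} {D : Type u₁} [Category.{v₁} D] [MonoidalCategory D] [MonoidalClosed D]
    (F : X → D) : Ty X → D
  | .var x => F x
  | .unit => 𝟙_ D
  | .tensor a b => Ty.interp F a ⊗ Ty.interp F b
  | .lolli a b => SMC.lolli (Ty.interp F a) (Ty.interp F b)

/-- A symmetric monoidal closed signature. -/
structure Signature : Type (u + 1) where
  /-- ground types -/
  X : Type u
  /-- ground terms -/
  Op : Type u
  src : Op → Ty X
  tgt : Op → Ty X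

/-- The derived terms over a signature. -/
inductive Term (S : Signature.{u}) : Ty S.X → Ty S.X → Type u
  | op (f : S.Op) : Term S (S.src f) (S.tgt f)
  | assoc (a b c : Ty S.X) : Term S (.tensor a (.tensor b c)) (.tensor (.tensor a b) c)
  | assocInv (a b c : Ty S.X) : Term S (.tensor (.tensor a b) c) (.tensor a (.tensor b c))
  | leftUnit (a : Ty S.X) : Term S (.tensor .unit a) a
  | leftUnitInv (a : Ty S.X) : Term S a (.tensor .unit a)
  | rightUnit (a : Ty S.X) : Term S (.tensor a .unit) a
  | rightUnitInv (a : Ty S.X) : Term S a (.tensor a .unit)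
  | symm (a b : Ty S.X) : Term S (.tensor a b) (.tensor b a)
  | eval (a b : Ty S.X) : Term S (.tensor (.lolli a b) a) b
  | coeval (a b : Ty S.X) : Term S a (.lolli b (.tensor a b))
  | comp {a b c : Ty S.X} (f : Term S a b) (g : Term S b c) : Term S a c
  | id (a : Ty S.X) : Term S a a
  | tensor {a b c d : Ty S.X} (f : Term S a b) (g : Term S c d) :
      Term S (.tensor a c) (.tensor b d)
  | lolli {a b c d : Ty S.X} (f : Term S a b) (g : Term S c d) :
      Term S (.lolli b c) (.lolli a d)

/-- A syntactic symmetric monoidal closed theory: a signature with a set of equations between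
parallel derived terms. -/
structure Theory : Type (u + 1) extends Signature.{u} where
  Eqn : ∀ {a b : Ty X}, Term toSignature a b → Term toSignature a b → Prop

/-- The theory with a given signature and no equations. -/
def Signature.free (S : Signature.{u}) : Theory.{u} where
  toSignature := S
  Eqn _ _ := False

section Interpretation

variable {D : Type u₁} [Category.{v₁} D] [MonoidalCategory D] [SymmetricCategory D]
  [MonoidalClosed D]

/-- The unique extension of an interpretation of the ground types and terms to the derived terms,
commuting with the term constructors. -/
def Term.interp {S : Signature.{u}} {obj : S.X → D}
    (op : ∀ f : S.Op, Ty.interp obj (S.src f) ⟶ Ty.interp obj (S.tgt f)) :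
    ∀ {a b : Ty S.X}, Term S a b → (Ty.interp obj a ⟶ Ty.interp obj b)
  | _, _, .op f => op f
  | _, _, .assoc a b c => (α_ (Ty.interp obj a) (Ty.interp obj b) (Ty.interp obj c)).inv
  | _, _, .assocInv a b c => (α_ (Ty.interp obj a) (Ty.interp obj b) (Ty.interp obj c)).hom
  | _, _, .leftUnit a => (λ_ (Ty.interp obj a)).hom
  | _, _, .leftUnitInv a => (λ_ (Ty.interp obj a)).inv
  | _, _, .rightUnit a => (ρ_ (Ty.interp obj a)).hom
  | _, _, .rightUnitInv a => (ρ_ (Ty.interp obj a)).inv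
  | _, _, .symm a b => (β_ (Ty.interp obj a) (Ty.interp obj b)).hom
  | _, _, .eval a b => SMC.eval (Ty.interp obj a) (Ty.interp obj b)
  | _, _, .coeval a b => SMC.coeval (Ty.interp obj a) (Ty.interp obj b)
  | _, _, .comp f g => Term.interp op f ≫ Term.interp op g
  | _, _, .id a => 𝟙 (Ty.interp obj a)
  | _, _, .tensor f g => Term.interp op f ⊗ₘ Term.interp op g
  | _, _, .lolli f g => lolliMap (Term.interp op f) (Term.interp op g)

end Interpretation

/-- An interpretation of a theory in a symmetric monoidal closed category. -/
@[ext]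
structure Interpretation (T : Theory.{u}) (D : Type u₁) [Category.{v₁} D] [MonoidalCategory D]
    [SymmetricCategory D] [MonoidalClosed D] where
  obj : T.X → D
  op (f : T.Op) : Ty.interp obj (T.src f) ⟶ Ty.interp obj (T.tgt f)
  sat {a b : Ty T.X} (p q : Term T.toSignature a b) : T.Eqn p q →
    Term.interp op p = Term.interp op q

section HEq

variable {D : Type u₂} [Category.{v₂} D]

theorem heq_map {E : Type u₃} [Category.{v₃} E] (G : D ⥤ E) {a b a' b' : D} {f : a ⟶ b}
    {f' : a' ⟶ b'} (ha : a = a') (hb : b = b') (h : HEq f f') : HEq (G.map f) (G.map f') := by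
  subst ha hb; cases h; rfl

theorem heq_comp {a b c a' b' c' : D} {f : a ⟶ b} {g : b ⟶ c} {f' : a' ⟶ b'}
    {g' : b' ⟶ c'} (ha : a = a') (hb : b = b') (hc : c = c') (hf : HEq f f') (hg : HEq g g') :
    HEq (f ≫ g) (f' ≫ g') := by
  subst ha hb hc; cases hf; cases hg; rfl

theorem heq_inv {a b a' b' : D} (e : a ≅ b) (e' : a' ≅ b') (ha : a = a') (hb : b = b')
    (h : HEq e.hom e'.hom) : HEq e.inv e'.inv := by
  subst ha hb
  have : e = e' := Iso.ext (eq_of_heq h)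
  rw [this]

theorem heq_id {a a' : D} (ha : a = a') : HEq (𝟙 a) (𝟙 a') := by
  subst ha; rfl

variable [MonoidalCategory D]

theorem heq_tensor {a b c d a' b' c' d' : D} {f : a ⟶ b} {g : c ⟶ d} {f' : a' ⟶ b'}
    {g' : c' ⟶ d'} (ha : a = a') (hb : b = b') (hc : c = c') (hd : d = d')
    (hf : HEq f f') (hg : HEq g g') : HEq (f ⊗ₘ g) (f' ⊗ₘ g') := by
  subst ha hb hc hd; cases hf; cases hg; rfl

theorem heq_associator {a b c a' b' c' : D} (ha : a = a') (hb : b = b') (hc : c = c') :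
    HEq (α_ a b c).hom (α_ a' b' c').hom := by
  subst ha hb hc; rfl

theorem heq_leftUnitor {a a' : D} (ha : a = a') : HEq (λ_ a).hom (λ_ a').hom := by
  subst ha; rfl

theorem heq_rightUnitor {a a' : D} (ha : a = a') : HEq (ρ_ a).hom (ρ_ a').hom := by
  subst ha; rfl

theorem heq_braiding [SymmetricCategory D] {a b a' b' : D} (ha : a = a') (hb : b = b') :
    HEq (β_ a b).hom (β_ a' b').hom := by
  subst ha hb; rfl

variable [MonoidalClosed D]

theorem heq_lolli {a b c d a' b' c' d' : D} {f : a ⟶ b} {g : c ⟶ d} {f' : a' ⟶ b'}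
    {g' : c' ⟶ d'} (ha : a = a') (hb : b = b') (hc : c = c') (hd : d = d')
    (hf : HEq f f') (hg : HEq g g') : HEq (lolliMap f g) (lolliMap f' g') := by
  subst ha hb hc hd; cases hf; cases hg; rfl

variable [SymmetricCategory D]

theorem heq_eval {a b a' b' : D} (ha : a = a') (hb : b = b') : HEq (eval a b) (eval a' b') := by
  subst ha hb; rfl

theorem heq_coeval {a b a' b' : D} (ha : a = a') (hb : b = b') :
    HEq (coeval a b) (coeval a' b') := by
  subst ha hb; rfl

end HEq

namespace StrictFunctor

variable {C : Type u₁} [Category.{v₁} C] [MonoidalCategory C] [SymmetricCategory C]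
  [MonoidalClosed C] {D : Type u₂} [Category.{v₂} D] [MonoidalCategory D] [SymmetricCategory D]
  [MonoidalClosed D]

/-- A strict functor commutes with the interpretation of types. -/
theorem obj_interp (H : StrictFunctor C D) {X : Type u} (F : X → C) (a : Ty X) :
    H.functor.obj (Ty.interp F a) = Ty.interp (fun x => H.functor.obj (F x)) a := by
  induction a with
  | var x => rfl
  | unit => exact H.obj_unit
  | tensor a b iha ihb => exact (H.obj_tensor _ _).trans (congrArg₂ _ iha ihb)
  | lolli a b iha ihb => exact (H.obj_lolli _ _).trans (congrArg₂ SMC.lolli iha ihb)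

/-- A strict functor commutes with the interpretation of terms. -/
theorem map_interp (H : StrictFunctor C D) {S : Signature.{u}} {obj : S.X → C}
    (op : ∀ f : S.Op, Ty.interp obj (S.src f) ⟶ Ty.interp obj (S.tgt f))
    {op' : ∀ f : S.Op, Ty.interp (fun x => H.functor.obj (obj x)) (S.src f) ⟶
      Ty.interp (fun x => H.functor.obj (obj x)) (S.tgt f)}
    (hop : ∀ f, HEq (H.functor.map (op f)) (op' f)) {a b : Ty S.X} (p : Term S a b) :
    HEq (H.functor.map (Term.interp op p)) (Term.interp op' p) := by
  have e := fun a => H.obj_interp obj a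
  induction p with
  | op f => exact hop f
  | assoc a b c =>
    exact heq_inv (H.functor.mapIso (α_ _ _ _)) (α_ _ _ _)
      (e ((a.tensor b).tensor c)) (e (a.tensor (b.tensor c)))
      ((H.map_associator _ _ _).trans (heq_associator (e a) (e b) (e c)))
  | assocInv a b c => exact (H.map_associator _ _ _).trans (heq_associator (e a) (e b) (e c))
  | leftUnit a => exact (H.map_leftUnitor _).trans (heq_leftUnitor (e a))
  | leftUnitInv a =>
    exact heq_inv (H.functor.mapIso (λ_ _)) (λ_ _) (e (Ty.unit.tensor a)) (e a)
      ((H.map_leftUnitor _).trans (heq_leftUnitor (e a)))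
  | rightUnit a => exact (H.map_rightUnitor _).trans (heq_rightUnitor (e a))
  | rightUnitInv a =>
    exact heq_inv (H.functor.mapIso (ρ_ _)) (ρ_ _) (e (a.tensor Ty.unit)) (e a)
      ((H.map_rightUnitor _).trans (heq_rightUnitor (e a)))
  | symm a b => exact (H.map_braiding _ _).trans (heq_braiding (e a) (e b))
  | eval a b => exact (H.map_eval _ _).trans (heq_eval (e a) (e b))
  | coeval a b => exact (H.map_coeval _ _).trans (heq_coeval (e a) (e b))
  | comp f g ihf ihg =>
    simp only [Term.interp, Functor.map_comp]
    exact heq_comp (e _) (e _) (e _) ihf ihg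
  | id a => exact (heq_of_eq (H.functor.map_id _)).trans (heq_id (e a))
  | tensor f g ihf ihg =>
    exact (H.map_tensor _ _).trans (heq_tensor (e _) (e _) (e _) (e _) ihf ihg)
  | lolli f g ihf ihg =>
    exact (H.map_lolli _ _).trans (heq_lolli (e _) (e _) (e _) (e _) ihf ihg)

/-- Composition of strict functors. -/
def comp {E : Type u₃} [Category.{v₃} E] [MonoidalCategory E] [SymmetricCategory E]
    [MonoidalClosed E] (F : StrictFunctor C D) (G : StrictFunctor D E) : StrictFunctor C E where
  functor := F.functor ⋙ G.functor
  obj_unit := by simp [F.obj_unit, G.obj_unit]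
  obj_tensor a b := by simp [F.obj_tensor, G.obj_tensor]
  obj_lolli a b := by
    simp only [Functor.comp_obj]
    rw [F.obj_lolli, G.obj_lolli]
  map_tensor f g := by
    refine HEq.trans ?_ (G.map_tensor _ _)
    exact heq_map G.functor (F.obj_tensor _ _) (F.obj_tensor _ _) (F.map_tensor f g)
  map_lolli f g := by
    refine HEq.trans ?_ (G.map_lolli _ _)
    exact heq_map G.functor (F.obj_lolli _ _) (F.obj_lolli _ _) (F.map_lolli f g)
  map_associator a b c := by
    refine HEq.trans ?_ (G.map_associator _ _ _)
    exact heq_map G.functor (by simp [F.obj_tensor]) (by simp [F.obj_tensor])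
      (F.map_associator a b c)
  map_leftUnitor a := by
    refine HEq.trans ?_ (G.map_leftUnitor _)
    exact heq_map G.functor (by simp [F.obj_tensor, F.obj_unit]) rfl (F.map_leftUnitor a)
  map_rightUnitor a := by
    refine HEq.trans ?_ (G.map_rightUnitor _)
    exact heq_map G.functor (by simp [F.obj_tensor, F.obj_unit]) rfl (F.map_rightUnitor a)
  map_braiding a b := by
    refine HEq.trans ?_ (G.map_braiding _ _)
    exact heq_map G.functor (F.obj_tensor _ _) (F.obj_tensor _ _) (F.map_braiding a b)
  map_eval a b := by
    refine HEq.trans ?_ (G.map_eval _ _)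
    exact heq_map G.functor ((F.obj_tensor _ _).trans (by rw [F.obj_lolli])) rfl (F.map_eval a b)
  map_coeval a b := by
    refine HEq.trans ?_ (G.map_coeval _ _)
    exact heq_map G.functor rfl ((F.obj_lolli _ _).trans (by rw [F.obj_tensor]))
      (F.map_coeval a b)

end StrictFunctor

/-- The image of an interpretation under a strict functor. -/
def Interpretation.map {T : Theory.{u}} {C : Type u₁} [Category.{v₁} C] [MonoidalCategory C]
    [SymmetricCategory C] [MonoidalClosed C] {D : Type u₂} [Category.{v₂} D] [MonoidalCategory D]
    [SymmetricCategory D] [MonoidalClosed D] (I : Interpretation T C) (H : StrictFunctor C D) :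
    Interpretation T D where
  obj x := H.functor.obj (I.obj x)
  op f := eqToHom (H.obj_interp I.obj (T.src f)).symm ≫ H.functor.map (I.op f) ≫
    eqToHom (H.obj_interp I.obj (T.tgt f))
  sat {a b} p q h := by
    have key := fun p : Term T.toSignature a b => H.map_interp I.op
      (op' := fun f => eqToHom (H.obj_interp I.obj (T.src f)).symm ≫ H.functor.map (I.op f) ≫
        eqToHom (H.obj_interp I.obj (T.tgt f))) (fun f => by simp) p
    exact eq_of_heq ((key p).symm.trans ((by rw [I.sat p q h] : HEq _ _).trans (key q)))

end SMC

namespace SMC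

/-- The smallest congruence on the derived terms of a theory which contains the equations of the
theory and makes the derived terms into a symmetric monoidal closed category. -/
inductive TermEq (T : Theory.{u}) : ∀ {a b : Ty T.X},
    Term T.toSignature a b → Term T.toSignature a b → Prop
  -- an equivalence relation, compatible with the term constructors
  | refl {a b} (f : Term T.toSignature a b) : TermEq T f f
  | symm {a b} {f g : Term T.toSignature a b} : TermEq T f g → TermEq T g f
  | trans {a b} {f g h : Term T.toSignature a b} : TermEq T f g → TermEq T g h → TermEq T f h
  | comp_congr {a b c} {f f' : Term T.toSignature a b} {g g' : Term T.toSignature b c} :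
      TermEq T f f' → TermEq T g g' → TermEq T (.comp f g) (.comp f' g')
  | tensor_congr {a b c d} {f f' : Term T.toSignature a b} {g g' : Term T.toSignature c d} :
      TermEq T f f' → TermEq T g g' → TermEq T (.tensor f g) (.tensor f' g')
  | lolli_congr {a b c d} {f f' : Term T.toSignature a b} {g g' : Term T.toSignature c d} :
      TermEq T f f' → TermEq T g g' → TermEq T (.lolli f g) (.lolli f' g')
  -- the equations of the theory
  | eqn {a b} {f g : Term T.toSignature a b} : T.Eqn f g → TermEq T f g
  -- composition is associative and unital
  | id_comp {a b} (f : Term T.toSignature a b) : TermEq T (.comp (.id a) f) f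
  | comp_id {a b} (f : Term T.toSignature a b) : TermEq T (.comp f (.id b)) f
  | comp_assoc {a b c d} (f : Term T.toSignature a b) (g : Term T.toSignature b c)
      (h : Term T.toSignature c d) :
      TermEq T (.comp (.comp f g) h) (.comp f (.comp g h))
  -- functoriality of the tensor product and of the internal hom
  | tensor_id (a b : Ty T.X) : TermEq T (.tensor (.id a) (.id b)) (.id (.tensor a b))
  | tensor_comp {a b c a' b' c'} (f : Term T.toSignature a b) (g : Term T.toSignature b c)
      (f' : Term T.toSignature a' b') (g' : Term T.toSignature b' c') :
      TermEq T (.tensor (.comp f g) (.comp f' g')) (.comp (.tensor f f') (.tensor g g'))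
  | lolli_id (a b : Ty T.X) : TermEq T (.lolli (.id a) (.id b)) (.id (.lolli a b))
  | lolli_comp {a b c a' b' c'} (f : Term T.toSignature a b) (g : Term T.toSignature b c)
      (f' : Term T.toSignature a' b') (g' : Term T.toSignature b' c') :
      TermEq T (.lolli (.comp f g) (.comp f' g')) (.comp (.lolli g f') (.lolli f g'))
  -- naturality of the structure maps
  | assoc_naturality {a b c a' b' c'} (f : Term T.toSignature a a')
      (g : Term T.toSignature b b') (h : Term T.toSignature c c') :
      TermEq T (.comp (.tensor f (.tensor g h)) (.assoc a' b' c'))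
        (.comp (.assoc a b c) (.tensor (.tensor f g) h))
  | leftUnit_naturality {a b} (f : Term T.toSignature a b) :
      TermEq T (.comp (.tensor (.id .unit) f) (.leftUnit b)) (.comp (.leftUnit a) f)
  | rightUnit_naturality {a b} (f : Term T.toSignature a b) :
      TermEq T (.comp (.tensor f (.id .unit)) (.rightUnit b)) (.comp (.rightUnit a) f)
  | symm_naturality {a b a' b'} (f : Term T.toSignature a a') (g : Term T.toSignature b b') :
      TermEq T (.comp (.tensor f g) (.symm a' b')) (.comp (.symm a b) (.tensor g f))
  | eval_naturality (a : Ty T.X) {b b'} (g : Term T.toSignature b b') :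
      TermEq T (.comp (.tensor (.lolli (.id a) g) (.id a)) (.eval a b')) (.comp (.eval a b) g)
  | eval_dinaturality {a a'} (f : Term T.toSignature a a') (b : Ty T.X) :
      TermEq T (.comp (.tensor (.lolli f (.id b)) (.id a)) (.eval a b))
        (.comp (.tensor (.id (.lolli a' b)) f) (.eval a' b))
  | coeval_naturality {a a'} (f : Term T.toSignature a a') (b : Ty T.X) :
      TermEq T (.comp f (.coeval a' b))
        (.comp (.coeval a b) (.lolli (.id b) (.tensor f (.id b))))
  | coeval_dinaturality (a : Ty T.X) {b b'} (g : Term T.toSignature b b') :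
      TermEq T (.comp (.coeval a b) (.lolli (.id b) (.tensor (.id a) g)))
        (.comp (.coeval a b') (.lolli g (.id (.tensor a b'))))
  -- inverses
  | assoc_hom_inv (a b c : Ty T.X) :
      TermEq T (.comp (.assoc a b c) (.assocInv a b c)) (.id _)
  | assoc_inv_hom (a b c : Ty T.X) :
      TermEq T (.comp (.assocInv a b c) (.assoc a b c)) (.id _)
  | leftUnit_hom_inv (a : Ty T.X) : TermEq T (.comp (.leftUnit a) (.leftUnitInv a)) (.id _)
  | leftUnit_inv_hom (a : Ty T.X) : TermEq T (.comp (.leftUnitInv a) (.leftUnit a)) (.id _)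
  | rightUnit_hom_inv (a : Ty T.X) : TermEq T (.comp (.rightUnit a) (.rightUnitInv a)) (.id _)
  | rightUnit_inv_hom (a : Ty T.X) : TermEq T (.comp (.rightUnitInv a) (.rightUnit a)) (.id _)
  -- the triangle identities for the unit and counit
  | triangle_left (a b : Ty T.X) :
      TermEq T (.comp (.tensor (.coeval a b) (.id b)) (.eval b (.tensor a b))) (.id _)
  | triangle_right (a b : Ty T.X) :
      TermEq T (.comp (.coeval (.lolli a b) a) (.lolli (.id a) (.eval a b))) (.id _)
  -- the axioms of a symmetric monoidal category
  | pentagon (a b c d : Ty T.X) :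
      TermEq T
        (.comp (.tensor (.assocInv a b c) (.id d))
          (.comp (.assocInv a (.tensor b c) d) (.tensor (.id a) (.assocInv b c d))))
        (.comp (.assocInv (.tensor a b) c d) (.assocInv a b (.tensor c d)))
  | triangle (a b : Ty T.X) :
      TermEq T (.comp (.assocInv a .unit b) (.tensor (.id a) (.leftUnit b)))
        (.tensor (.rightUnit a) (.id b))
  | hexagon (a b c : Ty T.X) :
      TermEq T
        (.comp (.assocInv a b c) (.comp (.symm a (.tensor b c)) (.assocInv b c a)))
        (.comp (.tensor (.symm a b) (.id c))
          (.comp (.assocInv b a c) (.tensor (.id b) (.symm a c))))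
  | symm_symm (a b : Ty T.X) : TermEq T (.comp (.symm a b) (.symm b a)) (.id _)

/-- The derived terms between two types modulo the congruence. -/
def termSetoid (T : Theory.{u}) (a b : Ty T.X) : Setoid (Term T.toSignature a b) where
  r := TermEq T
  iseqv := ⟨.refl, .symm, .trans⟩

/-- The objects of the category of derived terms of a theory: the types over its ground types. -/
structure SynCat (T : Theory.{u}) : Type u where
  ty : Ty T.X

namespace SynCat

variable {T : Theory.{u}}

instance : Category.{u} (SynCat T) where
  Hom a b := Quotient (termSetoid T a.ty b.ty)
  id a := Quotient.mk _ (.id a.ty)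
  comp f g := Quotient.map₂ .comp (fun _ _ h _ _ h' => TermEq.comp_congr h h') f g
  id_comp := by rintro _ _ ⟨f⟩; exact Quotient.sound (.id_comp f)
  comp_id := by rintro _ _ ⟨f⟩; exact Quotient.sound (.comp_id f)
  assoc := by rintro _ _ _ _ ⟨f⟩ ⟨g⟩ ⟨h⟩; exact Quotient.sound (.comp_assoc f g h)

/-- The morphism represented by a derived term. -/
def cls {a b : Ty T.X} (f : Term T.toSignature a b) : (⟨a⟩ : SynCat T) ⟶ ⟨b⟩ :=
  Quotient.mk (termSetoid T a b) f

theorem cls_surj {a b : SynCat T} (f : a ⟶ b) : ∃ p, f = cls p := by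
  obtain ⟨p, rfl⟩ := Quotient.exists_rep f
  exact ⟨p, rfl⟩

theorem sound {a b : Ty T.X} {f g : Term T.toSignature a b} (h : TermEq T f g) : cls f = cls g :=
  Quotient.sound h

theorem comp_cls {a b c : Ty T.X} (f : Term T.toSignature a b) (g : Term T.toSignature b c) :
    cls f ≫ cls g = cls (.comp f g) := rfl

/-- The tensor product of morphisms. -/
def tensorMap {a b c d : SynCat T} (f : a ⟶ b) (g : c ⟶ d) :
    (⟨.tensor a.ty c.ty⟩ : SynCat T) ⟶ ⟨.tensor b.ty d.ty⟩ :=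
  Quotient.map₂ .tensor (fun _ _ h _ _ h' => TermEq.tensor_congr h h') f g

/-- The internal hom of morphisms. -/
def homMap {a b c d : SynCat T} (f : a ⟶ b) (g : c ⟶ d) :
    (⟨.lolli b.ty c.ty⟩ : SynCat T) ⟶ ⟨.lolli a.ty d.ty⟩ :=
  Quotient.map₂ .lolli (fun _ _ h _ _ h' => TermEq.lolli_congr h h') f g

instance : MonoidalCategoryStruct (SynCat T) where
  tensorObj a b := ⟨.tensor a.ty b.ty⟩
  tensorUnit := ⟨.unit⟩
  tensorHom f g := tensorMap f g
  whiskerLeft a _ _ g := tensorMap (𝟙 a) g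
  whiskerRight f b := tensorMap f (𝟙 b)
  associator a b c := ⟨cls (.assocInv a.ty b.ty c.ty), cls (.assoc a.ty b.ty c.ty),
    sound (.assoc_inv_hom _ _ _), sound (.assoc_hom_inv _ _ _)⟩
  leftUnitor a := ⟨cls (.leftUnit a.ty), cls (.leftUnitInv a.ty),
    sound (.leftUnit_hom_inv _), sound (.leftUnit_inv_hom _)⟩
  rightUnitor a := ⟨cls (.rightUnit a.ty), cls (.rightUnitInv a.ty),
    sound (.rightUnit_hom_inv _), sound (.rightUnit_inv_hom _)⟩

theorem tensorMap_comp {a b c a' b' c' : SynCat T} (f : a ⟶ b) (g : b ⟶ c)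
    (f' : a' ⟶ b') (g' : b' ⟶ c') :
    tensorMap (f ≫ g) (f' ≫ g') = tensorMap f f' ≫ tensorMap g g' := by
  obtain ⟨f, rfl⟩ := cls_surj f
  obtain ⟨g, rfl⟩ := cls_surj g
  obtain ⟨f', rfl⟩ := cls_surj f'
  obtain ⟨g', rfl⟩ := cls_surj g'
  exact sound (.tensor_comp f g f' g')

theorem associator_inv_naturality {a b c a' b' c' : SynCat T} (f : a ⟶ a') (g : b ⟶ b')
    (h : c ⟶ c') :
    tensorMap f (tensorMap g h) ≫ cls (.assoc a'.ty b'.ty c'.ty) =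
      cls (.assoc a.ty b.ty c.ty) ≫ tensorMap (tensorMap f g) h := by
  obtain ⟨f, rfl⟩ := cls_surj f
  obtain ⟨g, rfl⟩ := cls_surj g
  obtain ⟨h, rfl⟩ := cls_surj h
  exact sound (.assoc_naturality f g h)

theorem associator_naturality {a b c a' b' c' : SynCat T} (f : a ⟶ a') (g : b ⟶ b')
    (h : c ⟶ c') :
    tensorMap (tensorMap f g) h ≫ (α_ a' b' c').hom =
      (α_ a b c).hom ≫ tensorMap f (tensorMap g h) := by
  rw [← Iso.inv_comp_eq, ← Category.assoc, ← Iso.eq_comp_inv]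
  exact (associator_inv_naturality f g h).symm

instance : MonoidalCategory (SynCat T) := MonoidalCategory.ofTensorHom
  (id_tensorHom_id := fun a b => sound (.tensor_id a.ty b.ty))
  (id_tensorHom := fun _ _ _ _ => rfl)
  (tensorHom_id := fun _ _ => rfl)
  (tensorHom_comp_tensorHom := fun f f' g g' => (tensorMap_comp f g f' g').symm)
  (associator_naturality := associator_naturality)
  (leftUnitor_naturality := fun f => by
    obtain ⟨f, rfl⟩ := cls_surj f
    exact sound (.leftUnit_naturality f))
  (rightUnitor_naturality := fun f => by
    obtain ⟨f, rfl⟩ := cls_surj f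
    exact sound (.rightUnit_naturality f))
  (pentagon := fun a b c d => sound (.pentagon a.ty b.ty c.ty d.ty))
  (triangle := fun a b => sound (.triangle a.ty b.ty))

/-- The symmetry. -/
def swap (a b : SynCat T) : a ⊗ b ≅ b ⊗ a :=
  ⟨cls (.symm a.ty b.ty), cls (.symm b.ty a.ty), sound (.symm_symm _ _), sound (.symm_symm _ _)⟩

theorem swap_hexagon (a b c : SynCat T) :
    (α_ a b c).hom ≫ (swap a (b ⊗ c)).hom ≫ (α_ b c a).hom =
      (swap a b).hom ▷ c ≫ (α_ b a c).hom ≫ b ◁ (swap a c).hom :=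
  sound (.hexagon a.ty b.ty c.ty)

instance : SymmetricCategory (SynCat T) where
  braiding := swap
  braiding_naturality_right a b c f := by
    obtain ⟨f, rfl⟩ := cls_surj f
    exact sound (.symm_naturality (.id a.ty) f)
  braiding_naturality_left f c := by
    obtain ⟨f, rfl⟩ := cls_surj f
    exact sound (.symm_naturality f (.id c.ty))
  hexagon_forward := swap_hexagon
  hexagon_reverse a b c := by
    have h : ((α_ c a b) ≪≫ (swap c (a ⊗ b)) ≪≫ (α_ a b c)) =
        (whiskerRightIso (swap c a) b ≪≫ (α_ a c b) ≪≫ whiskerLeftIso a (swap c b)) :=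
      Iso.ext (swap_hexagon c a b)
    have h' := congrArg Iso.inv h
    simp only [Iso.trans_inv, whiskerLeftIso_inv, whiskerRightIso_inv, Category.assoc] at h'
    exact h'
  symmetry a b := (swap a b).hom_inv_id

theorem braiding_hom (a b : SynCat T) : (β_ a b).hom = cls (.symm a.ty b.ty) := rfl

/-- The functor `a ⊸ -`. -/
def homFunctor (a : SynCat T) : SynCat T ⥤ SynCat T where
  obj b := ⟨.lolli a.ty b.ty⟩
  map f := homMap (𝟙 a) f
  map_id b := sound (.lolli_id a.ty b.ty)
  map_comp {b c d} f g := by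
    obtain ⟨f, rfl⟩ := cls_surj f
    obtain ⟨g, rfl⟩ := cls_surj g
    exact (sound (.lolli_congr (.symm (.id_comp (.id a.ty))) (.refl _))).trans
      (sound (.lolli_comp (.id a.ty) (.id a.ty) f g))

/-- The evaluation map. -/
def ev (a b : SynCat T) : (homFunctor a).obj b ⊗ a ⟶ b := cls (.eval a.ty b.ty)

/-- The coevaluation map. -/
def coev (a b : SynCat T) : a ⟶ (homFunctor b).obj (a ⊗ b) := cls (.coeval a.ty b.ty)

theorem ev_naturality (a : SynCat T) {b b' : SynCat T} (f : b ⟶ b') :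
    (homFunctor a).map f ▷ a ≫ ev a b' = ev a b ≫ f := by
  obtain ⟨f, rfl⟩ := cls_surj f
  exact sound (.eval_naturality a.ty f)

theorem coev_naturality {a a' : SynCat T} (f : a ⟶ a') (b : SynCat T) :
    f ≫ coev a' b = coev a b ≫ (homFunctor b).map (f ▷ b) := by
  obtain ⟨f, rfl⟩ := cls_surj f
  exact sound (.coeval_naturality f b.ty)

theorem triangle_left (a b : SynCat T) : coev a b ▷ b ≫ ev b (a ⊗ b) = 𝟙 _ :=
  sound (.triangle_left a.ty b.ty)

theorem triangle_right (a b : SynCat T) :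
    coev ((homFunctor a).obj b) a ≫ (homFunctor a).map (ev a b) = 𝟙 _ :=
  sound (.triangle_right a.ty b.ty)

/-- The adjunction between `a ⊗ -` and `a ⊸ -`, obtained from the unit and counit by means of the
symmetry. -/
def adj (a : SynCat T) : tensorLeft a ⊣ homFunctor a where
  unit :=
    { app := fun b => coev b a ≫ (homFunctor a).map (β_ b a).hom
      naturality := fun b c f => by
        simp only [Functor.id_obj, Functor.comp_obj, Functor.id_map, Functor.comp_map,
          tensorLeft, curriedTensor_obj_obj, curriedTensor_obj_map]
        rw [← Category.assoc, coev_naturality, Category.assoc, Category.assoc,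
          ← Functor.map_comp, ← Functor.map_comp, BraidedCategory.braiding_naturality_left] }
  counit :=
    { app := fun b => (β_ a ((homFunctor a).obj b)).hom ≫ ev a b
      naturality := fun b c f => by
        simp only [Functor.id_obj, Functor.comp_obj, Functor.id_map, Functor.comp_map,
          tensorLeft, curriedTensor_obj_obj, curriedTensor_obj_map]
        rw [BraidedCategory.braiding_naturality_right_assoc, ev_naturality, Category.assoc] }
  left_triangle_components b := by
    dsimp only [Functor.id_obj, Functor.comp_obj, tensorLeft, curriedTensor_obj_obj, curriedTensor_obj_map]
    rw [whiskerLeft_comp, Category.assoc, BraidedCategory.braiding_naturality_right_assoc,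
      ev_naturality, BraidedCategory.braiding_naturality_right_assoc,
      ← Category.assoc (coev b a ▷ a), triangle_left, Category.id_comp,
      SymmetricCategory.symmetry]
  right_triangle_components b := by
    dsimp only [Functor.id_obj, Functor.comp_obj, tensorLeft, curriedTensor_obj_obj, curriedTensor_obj_map]
    rw [Category.assoc, ← Functor.map_comp, SymmetricCategory.symmetry_assoc, triangle_right]

instance : MonoidalClosed (SynCat T) where
  closed a := { rightAdj := homFunctor a, adj := adj a }

end SynCat

end SMC

namespace SMC

section Lists

variable {K : Type u₁} [Category.{v₁} K] [MonoidalCategory K] {O : Type u} (t : O → K)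

/-- `tensorFrom t a [α₁, …, αₙ] = (…(a ⊗ t α₁) ⊗ …) ⊗ t αₙ`. -/
def tensorFrom : K → List O → K
  | a, [] => a
  | a, α :: Γ => tensorFrom (a ⊗ t α) Γ

/-- The tensor product of a list: `I` for the empty list, and `(…(t α₁ ⊗ t α₂) ⊗ …) ⊗ t αₙ` for the
list `[α₁, …, αₙ]` with `n ≥ 1`. -/
def listTensor : List O → K
  | [] => 𝟙_ K
  | α :: Γ => tensorFrom t (t α) Γ

/-- The right-bracketed tensor product of a list, used to construct the canonical isomorphisms. -/
def rightTensor : List O → K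
  | [] => 𝟙_ K
  | α :: Γ => t α ⊗ rightTensor Γ

/-- The canonical isomorphism, built from associativity and unitality constraints. -/
def tensorFromIso : (a : K) → (Γ : List O) → (tensorFrom t a Γ ≅ a ⊗ rightTensor t Γ)
  | a, [] => (ρ_ a).symm
  | a, α :: Γ => tensorFromIso (a ⊗ t α) Γ ≪≫ α_ a (t α) (rightTensor t Γ)

/-- The canonical isomorphism, built from associativity and unitality constraints. -/
def toRight : (Γ : List O) → (listTensor t Γ ≅ rightTensor t Γ)
  | [] => Iso.refl _
  | α :: Γ => tensorFromIso t (t α) Γ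

/-- The canonical isomorphism, built from associativity and unitality constraints. -/
def rightAppend : (Γ Δ : List O) →
    (rightTensor t Γ ⊗ rightTensor t Δ ≅ rightTensor t (Γ ++ Δ))
  | [], Δ => λ_ (rightTensor t Δ)
  | α :: Γ, Δ => α_ (t α) (rightTensor t Γ) (rightTensor t Δ) ≪≫
      whiskerLeftIso (t α) (rightAppend Γ Δ)

/-- The canonical isomorphism between the tensor product of two lists and the tensor product of
their concatenation, built from associativity and unitality constraints. -/
def appendIso (Γ Δ : List O) : listTensor t Γ ⊗ listTensor t Δ ≅ listTensor t (Γ ++ Δ) :=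
  (toRight t Γ ⊗ᵢ toRight t Δ) ≪≫ rightAppend t Γ Δ ≪≫ (toRight t (Γ ++ Δ)).symm

/-- The identity map between the tensor products of two equal lists. -/
def rightCast {Γ Δ : List O} (h : Γ = Δ) : rightTensor t Γ ⟶ rightTensor t Δ :=
  eqToHom (congrArg (rightTensor t) h)

/-- The identity map between the tensor products of two equal lists. -/
def listCast {Γ Δ : List O} (h : Γ = Δ) : listTensor t Γ ⟶ listTensor t Δ :=
  eqToHom (congrArg (listTensor t) h)

theorem listCast_rfl (Γ : List O) : listCast t (rfl : Γ = Γ) = 𝟙 _ := rfl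

theorem rightCast_cons (α : O) {Γ Δ : List O} (h : Γ = Δ) :
    rightCast t (congrArg (List.cons α) h) = t α ◁ rightCast t h := by
  subst h; exact (whiskerLeft_id _ _).symm

theorem rightAppend_nil (Γ : List O) :
    (rightAppend t Γ []).hom ≫ rightCast t (List.append_nil Γ) = (ρ_ (rightTensor t Γ)).hom := by
  induction Γ with
  | nil => exact (Category.comp_id _).trans unitors_equal
  | cons α Γ ih =>
    change ((α_ (t α) (rightTensor t Γ) (𝟙_ K)).hom ≫ t α ◁ (rightAppend t Γ []).hom) ≫
      rightCast t (congrArg (List.cons α) (List.append_nil Γ)) = _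
    rw [rightCast_cons t α (List.append_nil Γ)]
    change ((α_ (t α) (rightTensor t Γ) (𝟙_ K)).hom ≫
      t α ◁ ((rightAppend t Γ []).hom : rightTensor t Γ ⊗ rightTensor t [] ⟶ _)) ≫
      t α ◁ rightCast t (List.append_nil Γ) = _
    refine (Category.assoc _ _ _).trans ?_
    refine (congrArg (fun z => (α_ (t α) (rightTensor t Γ) (𝟙_ K)).hom ≫ z)
      ((whiskerLeft_comp _ _ _).symm.trans (congrArg (fun z => t α ◁ z) ih))).trans ?_
    exact (rightUnitor_tensor_hom _ _).symm

theorem rightAppend_assoc (Γ Δ Θ : List O) :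
    (rightAppend t Γ Δ).hom ▷ rightTensor t Θ ≫ (rightAppend t (Γ ++ Δ) Θ).hom ≫
      rightCast t (List.append_assoc Γ Δ Θ) =
    (α_ _ _ _).hom ≫ rightTensor t Γ ◁ (rightAppend t Δ Θ).hom ≫
      (rightAppend t Γ (Δ ++ Θ)).hom := by
  induction Γ with
  | nil =>
    simp only [rightAppend, rightTensor, List.nil_append]
    erw [Category.comp_id]
    simp
  | cons α Γ ih =>
    change ((α_ (t α) (rightTensor t Γ) (rightTensor t Δ)).hom ≫
        t α ◁ (rightAppend t Γ Δ).hom) ▷ rightTensor t Θ ≫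
      ((α_ (t α) (rightTensor t (Γ ++ Δ)) (rightTensor t Θ)).hom ≫
        t α ◁ (rightAppend t (Γ ++ Δ) Θ).hom) ≫
        rightCast t (congrArg (List.cons α) (List.append_assoc Γ Δ Θ)) =
      (α_ (t α ⊗ rightTensor t Γ) _ _).hom ≫ (t α ⊗ rightTensor t Γ) ◁ (rightAppend t Δ Θ).hom ≫
        (α_ (t α) (rightTensor t Γ) (rightTensor t (Δ ++ Θ))).hom ≫
          t α ◁ (rightAppend t Γ (Δ ++ Θ)).hom
    have h : (α_ (t α) (rightTensor t Γ) (rightTensor t Δ)).hom ▷ rightTensor t Θ ≫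
        (t α ◁ (rightAppend t Γ Δ).hom) ▷ rightTensor t Θ ≫
        (α_ (t α) (rightTensor t (Γ ++ Δ)) (rightTensor t Θ)).hom ≫
        t α ◁ (rightAppend t (Γ ++ Δ) Θ).hom ≫
          t α ◁ rightCast t (List.append_assoc Γ Δ Θ) =
        (α_ _ _ _).hom ▷ rightTensor t Θ ≫ (α_ _ _ _).hom ≫
        t α ◁ ((rightAppend t Γ Δ).hom ▷ rightTensor t Θ ≫ (rightAppend t (Γ ++ Δ) Θ).hom ≫
          rightCast t (List.append_assoc Γ Δ Θ)) := by
      simp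
    rw [rightCast_cons t α (List.append_assoc Γ Δ Θ)]
    change _ ≫ (_ ≫ t α ◁ (rightAppend t (Γ ++ Δ) Θ).hom) ≫
      t α ◁ rightCast t (List.append_assoc Γ Δ Θ) = _
    rw [comp_whiskerRight, Category.assoc, Category.assoc]
    refine h.trans ?_
    rw [ih]
    simp

theorem toRight_inv_cast {Γ Δ : List O} (h : Γ = Δ) :
    (toRight t Γ).inv ≫ listCast t h = rightCast t h ≫ (toRight t Δ).inv := by
  subst h; exact (Category.comp_id _).trans (Category.id_comp _).symm

theorem appendIso_nil (Γ : List O) :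
    (appendIso t Γ []).hom ≫ listCast t (List.append_nil Γ) = (ρ_ (listTensor t Γ)).hom := by
  have h1 : (toRight t Γ ⊗ᵢ toRight t []).hom = (toRight t Γ).hom ▷ 𝟙_ K := tensorHom_id _ _
  have h2 := rightAppend_nil t Γ
  simp only [appendIso, Iso.trans_hom, Iso.symm_hom, Category.assoc, toRight_inv_cast]
  rw [reassoc_of% h2, h1]
  exact (rightUnitor_naturality_assoc _ _).trans (by simp)

theorem nil_appendIso (Γ : List O) : (appendIso t [] Γ).hom = (λ_ (listTensor t Γ)).hom := by
  have h1 : (toRight t [] ⊗ᵢ toRight t Γ).hom = 𝟙_ K ◁ (toRight t Γ).hom := id_tensorHom _ _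
  change (toRight t [] ⊗ᵢ toRight t Γ).hom ≫ (λ_ (rightTensor t Γ)).hom ≫ (toRight t Γ).inv = _
  rw [h1]
  exact (leftUnitor_naturality_assoc _ _).trans (by simp)

theorem appendIso_assoc (Γ Δ Θ : List O) :
    (appendIso t Γ Δ).hom ▷ listTensor t Θ ≫ (appendIso t (Γ ++ Δ) Θ).hom ≫
      listCast t (List.append_assoc Γ Δ Θ) =
    (α_ _ _ _).hom ≫ listTensor t Γ ◁ (appendIso t Δ Θ).hom ≫
      (appendIso t Γ (Δ ++ Θ)).hom := by
  have key := rightAppend_assoc t Γ Δ Θ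
  simp only [appendIso, Iso.trans_hom, Iso.symm_hom, Category.assoc, toRight_inv_cast,
    tensorIso_hom, comp_whiskerRight, whiskerLeft_comp]
  have e1 : (toRight t (Γ ++ Δ)).inv ▷ listTensor t Θ ≫
      ((toRight t (Γ ++ Δ)).hom ⊗ₘ (toRight t Θ).hom) =
      rightTensor t (Γ ++ Δ) ◁ (toRight t Θ).hom := by
    rw [MonoidalCategory.tensorHom_def, inv_hom_whiskerRight_assoc]
  have e2 : listTensor t Γ ◁ (toRight t (Δ ++ Θ)).inv ≫
      ((toRight t Γ).hom ⊗ₘ (toRight t (Δ ++ Θ)).hom) =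
      (toRight t Γ).hom ▷ rightTensor t (Δ ++ Θ) := by
    rw [MonoidalCategory.tensorHom_def', whiskerLeft_inv_hom_assoc]
  have e3 : ((toRight t Γ).hom ⊗ₘ (toRight t Δ).hom) ▷ listTensor t Θ ≫
      (rightTensor t Γ ⊗ rightTensor t Δ) ◁ (toRight t Θ).hom ≫ (α_ _ _ _).hom =
      (α_ _ _ _).hom ≫ listTensor t Γ ◁ ((toRight t Δ).hom ⊗ₘ (toRight t Θ).hom) ≫
        (toRight t Γ).hom ▷ (rightTensor t Δ ⊗ rightTensor t Θ) := by
    rw [← Category.assoc, ← MonoidalCategory.tensorHom_def, associator_naturality,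
      ← MonoidalCategory.tensorHom_def']
  rw [reassoc_of% e1, reassoc_of% e2, ← whisker_exchange_assoc, reassoc_of% key,
    whisker_exchange_assoc, reassoc_of% e3]

end Lists

end SMC

namespace SMC

section Perm

variable {O : Type u}

/-- Positions in a concatenation of two lists. -/
def splitFin (Γ Δ : List O) : Fin (Γ ++ Δ).length ≃ Fin Γ.length ⊕ Fin Δ.length :=
  (finCongr List.length_append).trans finSumFinEquiv.symm

/-- The juxtaposition of two permutations. -/
def appendPerm {Γ Γ' Δ Δ' : List O} (σ : Fin Γ'.length ≃ Fin Γ.length)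
    (τ : Fin Δ'.length ≃ Fin Δ.length) : Fin (Γ' ++ Δ').length ≃ Fin (Γ ++ Δ).length :=
  (splitFin Γ' Δ').trans ((Equiv.sumCongr σ τ).trans (splitFin Γ Δ).symm)

/-- The permutation exchanging two blocks. -/
def swapPerm (Γ Δ : List O) : Fin (Δ ++ Γ).length ≃ Fin (Γ ++ Δ).length :=
  (splitFin Δ Γ).trans ((Equiv.sumComm _ _).trans (splitFin Γ Δ).symm)

variable {K : Type u₁} [Category.{v₁} K] [MonoidalCategory K] [SymmetricCategory K] (t : O → K)

/-- `IsPermMap t σ m` says that `m` is the canonical map from the tensor product of a list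
`Γ = [α₁, …, αₙ]` to the tensor product of the permuted list `Δ = [α_{σ(1)}, …, α_{σ(n)}]`, built
from symmetries and associativity and unitality constraints. -/
inductive IsPermMap : ∀ {Γ Δ : List O}, (Fin Δ.length ≃ Fin Γ.length) →
    (listTensor t Γ ⟶ listTensor t Δ) → Prop
  | id (Γ : List O) : IsPermMap (Equiv.refl _) (𝟙 (listTensor t Γ))
  | comp {Γ Δ Θ : List O} {σ : Fin Δ.length ≃ Fin Γ.length} {τ : Fin Θ.length ≃ Fin Δ.length}
      {m : listTensor t Γ ⟶ listTensor t Δ} {m' : listTensor t Δ ⟶ listTensor t Θ} :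
      IsPermMap σ m → IsPermMap τ m' → IsPermMap (τ.trans σ) (m ≫ m')
  | append {Γ Γ' Δ Δ' : List O} {σ : Fin Γ'.length ≃ Fin Γ.length}
      {τ : Fin Δ'.length ≃ Fin Δ.length} {m : listTensor t Γ ⟶ listTensor t Γ'}
      {m' : listTensor t Δ ⟶ listTensor t Δ'} :
      IsPermMap σ m → IsPermMap τ m' → IsPermMap (appendPerm σ τ)
        ((appendIso t Γ Δ).inv ≫ (m ⊗ₘ m') ≫ (appendIso t Γ' Δ').hom)
  | swap (Γ Δ : List O) : IsPermMap (swapPerm Γ Δ)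
      ((appendIso t Γ Δ).inv ≫ (β_ (listTensor t Γ) (listTensor t Δ)).hom ≫ (appendIso t Δ Γ).hom)

end Perm

section ListCat

variable {K : Type u₁} [Category.{v₁} K] [MonoidalCategory K] {O : Type u}

/-- The objects of the category whose morphisms `U ⟶ V` are pairs of a list `Γ` and a morphism
`listTensor t Γ ⊗ U ⟶ V` of `K`: the objects of `K`. -/
structure ListCat (t : O → K) : Type u₁ where
  obj : K

variable (t : O → K)

/-- A list `Γ` together with a morphism `listTensor t Γ ⊗ U ⟶ V`. -/
structure ListHom (U V : K) : Type (max u v₁) where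
  list : List O
  map : listTensor t list ⊗ U ⟶ V

variable {t}

namespace ListHom

/-- The identity: the empty list together with the unit isomorphism. -/
def id (t : O → K) (U : K) : ListHom t U U := ⟨[], (λ_ U).hom⟩

/-- The composite of `(Γ, φ) : U ⟶ V` and `(Δ, ψ) : V ⟶ W` is `(Δ ++ Γ, ξ)`, where `ξ` is the
composite of the canonical isomorphism, `listTensor t Δ ◁ φ` and `ψ`. -/
def comp {U V W : K} (f : ListHom t U V) (g : ListHom t V W) : ListHom t U W :=
  ⟨g.list ++ f.list, (appendIso t g.list f.list).inv ▷ U ≫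
    (α_ (listTensor t g.list) (listTensor t f.list) U).hom ≫ listTensor t g.list ◁ f.map ≫ g.map⟩

/-- The morphism given by a map out of `A ⊗ U`, where `A` is isomorphic to the tensor product of a
list. -/
def ofIso {U V A : K} {Γ : List O} (e : A ≅ listTensor t Γ) (φ : A ⊗ U ⟶ V) : ListHom t U V :=
  ⟨Γ, e.inv ▷ U ≫ φ⟩

/-- The tensor product of two objects, each isomorphic to the tensor product of a list, is
isomorphic to the tensor product of the concatenated list. -/
def cat {A B : K} {Γ Δ : List O} (e : A ≅ listTensor t Γ) (e' : B ≅ listTensor t Δ) :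
    A ⊗ B ≅ listTensor t (Γ ++ Δ) :=
  (e ⊗ᵢ e') ≪≫ appendIso t Γ Δ

/-- The unit object as the tensor product of the empty list. -/
def nilIso (t : O → K) : 𝟙_ K ≅ listTensor t [] := Iso.refl _

theorem exists_ofIso {U V : K} (f : ListHom t U V) :
    ∃ (A : K) (e : A ≅ listTensor t f.list) (φ : A ⊗ U ⟶ V), f = ofIso e φ :=
  ⟨_, Iso.refl _, f.map, by cases f; simp [ofIso]⟩

theorem ofIso_cast {U V A B : K} {Γ Δ : List O} {e : A ≅ listTensor t Γ} {e' : B ≅ listTensor t Δ}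
    (m : A ⟶ B) (h : Γ = Δ) (hm : e.hom ≫ listCast t h = m ≫ e'.hom) (φ : B ⊗ U ⟶ V) :
    ofIso e (m ▷ U ≫ φ) = ofIso e' φ := by
  subst h
  have h' : e.inv ≫ m = e'.inv := by
    rw [Iso.inv_comp_eq, ← cancel_mono e'.hom, ← hm]
    simp [listCast]
  simp only [ofIso]
  rw [← comp_whiskerRight_assoc, h']

theorem id_eq (U : K) : id t U = ofIso (nilIso t) (λ_ U).hom := by
  have h : (nilIso t).inv ▷ U = 𝟙 (𝟙_ K ⊗ U) := id_whiskerRight _ _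
  exact congrArg (ListHom.mk []) ((congrArg (· ≫ (λ_ U).hom) h).trans (Category.id_comp _)).symm

theorem comp_ofIso {U V W A B : K} {Γ Δ : List O} (e : A ≅ listTensor t Γ) (φ : A ⊗ U ⟶ V)
    (e' : B ≅ listTensor t Δ) (ψ : B ⊗ V ⟶ W) :
    comp (ofIso e φ) (ofIso e' ψ) = ofIso (cat e' e) ((α_ B A U).hom ≫ B ◁ φ ≫ ψ) := by
  have h : (α_ (listTensor t Δ) (listTensor t Γ) U).hom ≫
      listTensor t Δ ◁ (e.inv ▷ U ≫ φ) ≫ e'.inv ▷ V ≫ ψ =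
      (e'.inv ⊗ₘ e.inv) ▷ U ≫ (α_ B A U).hom ≫ B ◁ φ ≫ ψ := by
    rw [whiskerLeft_comp, Category.assoc, whisker_exchange_assoc, MonoidalCategory.tensorHom_def']
    simp
  simp only [comp, ofIso, cat, Iso.trans_inv, tensorIso_inv, comp_whiskerRight, Category.assoc, h]

theorem cat_nil {A : K} {Γ : List O} (e : A ≅ listTensor t Γ) :
    (cat e (nilIso t)).hom ≫ listCast t (List.append_nil Γ) = (ρ_ A).hom ≫ e.hom := by
  have h1 : (e ⊗ᵢ nilIso t).hom = e.hom ▷ 𝟙_ K := tensorHom_id _ _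
  have h2 : (cat e (nilIso t)).hom = e.hom ▷ 𝟙_ K ≫ (appendIso t Γ []).hom := by rw [← h1]; rfl
  refine ((congrArg (· ≫ _) h2).trans (Category.assoc _ _ _)).trans ?_
  exact (congrArg (e.hom ▷ 𝟙_ K ≫ ·) (appendIso_nil t Γ)).trans
    (MonoidalCategory.rightUnitor_naturality e.hom)

theorem nil_cat {A : K} {Γ : List O} (e : A ≅ listTensor t Γ) :
    (cat (nilIso t) e).hom ≫ listCast t (List.nil_append Γ) = (λ_ A).hom ≫ e.hom := by
  have h1 : (nilIso t ⊗ᵢ e).hom = 𝟙_ K ◁ e.hom := id_tensorHom _ _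
  have h2 : (cat (nilIso t) e).hom = 𝟙_ K ◁ e.hom ≫ (λ_ (listTensor t Γ)).hom := by
    simp only [cat, Iso.trans_hom, nil_appendIso, h1]
    rfl
  rw [h2]
  exact (Category.comp_id _).trans (leftUnitor_naturality _)

theorem cat_assoc {A B C : K} {Γ Δ Θ : List O} (e₁ : A ≅ listTensor t Γ) (e₂ : B ≅ listTensor t Δ)
    (e₃ : C ≅ listTensor t Θ) :
    (cat (cat e₁ e₂) e₃).hom ≫ listCast t (List.append_assoc Γ Δ Θ) =
      (α_ A B C).hom ≫ (cat e₁ (cat e₂ e₃)).hom := by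
  have key := appendIso_assoc t Γ Δ Θ
  have h1 : (((e₁.hom ⊗ₘ e₂.hom) ≫ (appendIso t Γ Δ).hom) ⊗ₘ e₃.hom) =
      ((e₁.hom ⊗ₘ e₂.hom) ⊗ₘ e₃.hom) ≫ (appendIso t Γ Δ).hom ▷ listTensor t Θ := by
    rw [← tensorHom_id, tensorHom_comp_tensorHom, Category.comp_id]
  have h2 : (e₁.hom ⊗ₘ ((e₂.hom ⊗ₘ e₃.hom) ≫ (appendIso t Δ Θ).hom)) =
      (e₁.hom ⊗ₘ (e₂.hom ⊗ₘ e₃.hom)) ≫ listTensor t Γ ◁ (appendIso t Δ Θ).hom := by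
    rw [← id_tensorHom, tensorHom_comp_tensorHom, Category.comp_id]
  simp only [cat, Iso.trans_hom, tensorIso_hom, Category.assoc, h1, h2, key]
  rw [associator_naturality_assoc]

theorem id_comp {U V : K} (f : ListHom t U V) : comp (id t U) f = f := by
  obtain ⟨A, e, φ, hf⟩ := exists_ofIso f
  rw [hf, id_eq, comp_ofIso, triangle_assoc]
  exact ofIso_cast _ _ (cat_nil e) φ

theorem comp_id {U V : K} (f : ListHom t U V) : comp f (id t V) = f := by
  obtain ⟨A, e, φ, hf⟩ := exists_ofIso f
  rw [hf, id_eq, comp_ofIso]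
  have : (α_ (𝟙_ K) A U).hom ≫ 𝟙_ K ◁ φ ≫ (λ_ V).hom = (λ_ A).hom ▷ U ≫ φ := by simp
  rw [this]
  exact ofIso_cast _ _ (nil_cat e) φ

theorem comp_assoc {U V W Z : K} (f : ListHom t U V) (g : ListHom t V W) (h : ListHom t W Z) :
    comp (comp f g) h = comp f (comp g h) := by
  obtain ⟨A, e₁, φ, hf⟩ := exists_ofIso f
  obtain ⟨B, e₂, ψ, hg⟩ := exists_ofIso g
  obtain ⟨C, e₃, χ, hh⟩ := exists_ofIso h
  rw [hf, hg, hh]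
  simp only [comp_ofIso]
  rw [← ofIso_cast _ _ (cat_assoc e₃ e₂ e₁)]
  congr 1
  simp

/-- The identity on objects embedding of `K`: the empty list together with the unit isomorphism
followed by the given morphism. -/
def incl (t : O → K) {U V : K} (f : U ⟶ V) : ListHom t U V := ⟨[], (λ_ U).hom ≫ f⟩

theorem incl_eq {U V : K} (f : U ⟶ V) : incl t f = ofIso (nilIso t) ((λ_ U).hom ≫ f) := by
  have h : (nilIso t).inv ▷ U = 𝟙 (𝟙_ K ⊗ U) := id_whiskerRight _ _
  exact congrArg (ListHom.mk [])
    ((congrArg (· ≫ (λ_ U).hom ≫ f) h).trans (Category.id_comp _)).symm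

theorem id_eq_incl (U : K) : id t U = incl t (𝟙 U) := by
  exact congrArg (ListHom.mk []) (Category.comp_id _).symm

theorem comp_incl {U V W A : K} {Γ : List O} (e : A ≅ listTensor t Γ) (φ : A ⊗ U ⟶ V)
    (g : V ⟶ W) : comp (ofIso e φ) (incl t g) = ofIso e (φ ≫ g) := by
  rw [incl_eq, comp_ofIso, ← ofIso_cast _ _ (nil_cat e)]
  congr 1
  simp

theorem incl_comp {U V W A : K} {Γ : List O} (f : U ⟶ V) (e : A ≅ listTensor t Γ)
    (φ : A ⊗ V ⟶ W) : comp (incl t f) (ofIso e φ) = ofIso e (A ◁ f ≫ φ) := by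
  rw [incl_eq, comp_ofIso, ← ofIso_cast _ _ (cat_nil e)]
  congr 1
  simp

theorem incl_comp_incl {U V W : K} (f : U ⟶ V) (g : V ⟶ W) :
    comp (incl t f) (incl t g) = incl t (f ≫ g) := by
  rw [incl_eq f, comp_incl, incl_eq, Category.assoc]

end ListHom

instance : Category.{max u v₁} (ListCat t) where
  Hom U V := ListHom t U.obj V.obj
  id U := ListHom.id t U.obj
  comp f g := ListHom.comp f g
  id_comp := ListHom.id_comp
  comp_id := ListHom.comp_id
  assoc := ListHom.comp_assoc

end ListCat

end SMC

namespace SMC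

variable {K : Type u₁} [Category.{v₁} K] [MonoidalCategory K] [SymmetricCategory K] {O : Type u}

namespace ListHom

variable {t : O → K}

/-- The tensor product of `(Γ, φ) : U ⟶ V` and `(Γ', φ') : U' ⟶ V'` is `(Γ ++ Γ', θ)`, where `θ` is
the canonical isomorphism
`listTensor t (Γ ++ Γ') ⊗ (U ⊗ U') ≅ (listTensor t Γ ⊗ U) ⊗ (listTensor t Γ' ⊗ U')`
followed by `φ ⊗ φ'`. -/
def tensor {U V U' V' : K} (f : ListHom t U V) (f' : ListHom t U' V') :
    ListHom t (U ⊗ U') (V ⊗ V') :=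
  ⟨f.list ++ f'.list, (appendIso t f.list f'.list).inv ▷ (U ⊗ U') ≫
    tensorμ (listTensor t f.list) (listTensor t f'.list) U U' ≫ (f.map ⊗ₘ f'.map)⟩

theorem tensor_ofIso {U V U' V' A A' : K} {Γ Γ' : List O} (e : A ≅ listTensor t Γ)
    (φ : A ⊗ U ⟶ V) (e' : A' ≅ listTensor t Γ') (φ' : A' ⊗ U' ⟶ V') :
    tensor (ofIso e φ) (ofIso e' φ') = ofIso (cat e e') (tensorμ A A' U U' ≫ (φ ⊗ₘ φ')) := by
  simp only [tensor, ofIso, cat, Iso.trans_inv, tensorIso_inv, comp_whiskerRight, Category.assoc]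
  rw [tensorμ_natural_left_assoc, tensorHom_comp_tensorHom]

theorem incl_tensor_incl {U V U' V' : K} (f : U ⟶ V) (g : U' ⟶ V') :
    tensor (incl t f) (incl t g) = incl t (f ⊗ₘ g) := by
  rw [incl_eq f, incl_eq g, incl_eq, tensor_ofIso, ← ofIso_cast _ _ (nil_cat (nilIso t))]
  congr 1
  rw [tensor_left_unitality]
  simp

end ListHom

/-- The generators of the relation on morphisms given by the action of the symmetric groups on
lists: `(Δ, φ) ∼ (Γ, (σ̂ ▷ U) ≫ φ)`, where `Δ` is the list `Γ` permuted by `σ` and `σ̂` is the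
canonical map between their tensor products. -/
inductive PermStep (t : O → K) {U V : K} : ListHom t U V → ListHom t U V → Prop
  | mk {Γ Δ : List O} (σ : Fin Δ.length ≃ Fin Γ.length) (m : listTensor t Γ ⟶ listTensor t Δ)
      (h : IsPermMap t σ m) (φ : listTensor t Δ ⊗ U ⟶ V) :
      PermStep t ⟨Δ, φ⟩ ⟨Γ, m ▷ U ≫ φ⟩

/-- The equivalence relation generated by the action of the symmetric groups on lists. -/
def permRel (t : O → K) : HomRel (ListCat t) :=
  fun U V (f g : ListHom t U.obj V.obj) => Relation.EqvGen (PermStep t) f g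

theorem eqvGen_map {α β : Type*} {r : α → α → Prop} {s : β → β → Prop} (F : α → β)
    (h : ∀ a b, r a b → s (F a) (F b)) {a b : α} (hab : Relation.EqvGen r a b) :
    Relation.EqvGen s (F a) (F b) := by
  induction hab with
  | rel a b h' => exact .rel _ _ (h a b h')
  | refl a => exact .refl _
  | symm a b _ ih => exact .symm _ _ ih
  | trans a b c _ _ ih ih' => exact .trans _ _ _ ih ih'

variable {t : O → K}

theorem PermStep.comp_left {U V W : K} {f f' : ListHom t U V} (h : PermStep t f f')
    (g : ListHom t V W) : PermStep t (f.comp g) (f'.comp g) := by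
  obtain @⟨Γ, Δ, σ, m, h, φ⟩ := h
  have key := PermStep.mk _ _ (IsPermMap.append (IsPermMap.id (t := t) g.list) h)
    ((appendIso t g.list Δ).inv ▷ U ≫ (α_ (listTensor t g.list) (listTensor t Δ) U).hom ≫
      listTensor t g.list ◁ φ ≫ g.map)
  have e : ((appendIso t g.list Γ).inv ≫ (𝟙 (listTensor t g.list) ⊗ₘ m) ≫
      (appendIso t g.list Δ).hom) ▷ U ≫ (appendIso t g.list Δ).inv ▷ U ≫
      (α_ (listTensor t g.list) (listTensor t Δ) U).hom ≫ listTensor t g.list ◁ φ ≫ g.map =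
      (appendIso t g.list Γ).inv ▷ U ≫ (α_ (listTensor t g.list) (listTensor t Γ) U).hom ≫
      listTensor t g.list ◁ (m ▷ U ≫ φ) ≫ g.map := by simp
  rw [e] at key
  exact key

theorem PermStep.comp_right {U V W : K} (f : ListHom t U V) {g g' : ListHom t V W}
    (h : PermStep t g g') : PermStep t (f.comp g) (f.comp g') := by
  obtain @⟨Γ, Δ, σ, m, h, φ⟩ := h
  have key := PermStep.mk _ _ (IsPermMap.append h (IsPermMap.id (t := t) f.list))
    ((appendIso t Δ f.list).inv ▷ U ≫ (α_ (listTensor t Δ) (listTensor t f.list) U).hom ≫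
      listTensor t Δ ◁ f.map ≫ φ)
  have e : ((appendIso t Γ f.list).inv ≫ (m ⊗ₘ 𝟙 (listTensor t f.list)) ≫
      (appendIso t Δ f.list).hom) ▷ U ≫ (appendIso t Δ f.list).inv ▷ U ≫
      (α_ (listTensor t Δ) (listTensor t f.list) U).hom ≫ listTensor t Δ ◁ f.map ≫ φ =
      (appendIso t Γ f.list).inv ▷ U ≫ (α_ (listTensor t Γ) (listTensor t f.list) U).hom ≫
      listTensor t Γ ◁ f.map ≫ m ▷ V ≫ φ := by simp [whisker_exchange_assoc]
  rw [e] at key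
  exact key

theorem PermStep.tensor_left {U V U' V' : K} {f f' : ListHom t U V} (h : PermStep t f f')
    (g : ListHom t U' V') : PermStep t (f.tensor g) (f'.tensor g) := by
  obtain @⟨Γ, Δ, σ, m, h, φ⟩ := h
  have key := PermStep.mk _ _ (IsPermMap.append h (IsPermMap.id (t := t) g.list))
    ((appendIso t Δ g.list).inv ▷ (U ⊗ U') ≫
      tensorμ (listTensor t Δ) (listTensor t g.list) U U' ≫ (φ ⊗ₘ g.map))
  have e : ((appendIso t Γ g.list).inv ≫ (m ⊗ₘ 𝟙 (listTensor t g.list)) ≫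
      (appendIso t Δ g.list).hom) ▷ (U ⊗ U') ≫ (appendIso t Δ g.list).inv ▷ (U ⊗ U') ≫
      tensorμ (listTensor t Δ) (listTensor t g.list) U U' ≫ (φ ⊗ₘ g.map) =
      (appendIso t Γ g.list).inv ▷ (U ⊗ U') ≫
      tensorμ (listTensor t Γ) (listTensor t g.list) U U' ≫ (m ▷ U ≫ φ ⊗ₘ g.map) := by
    simp only [comp_whiskerRight, Category.assoc, hom_inv_whiskerRight_assoc]
    rw [tensorμ_natural_left_assoc, tensorHom_comp_tensorHom, id_whiskerRight, Category.id_comp]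
  rw [e] at key
  exact key

theorem PermStep.tensor_right {U V U' V' : K} (f : ListHom t U V) {g g' : ListHom t U' V'}
    (h : PermStep t g g') : PermStep t (f.tensor g) (f.tensor g') := by
  obtain @⟨Γ, Δ, σ, m, h, φ⟩ := h
  have key := PermStep.mk _ _ (IsPermMap.append (IsPermMap.id (t := t) f.list) h)
    ((appendIso t f.list Δ).inv ▷ (U ⊗ U') ≫
      tensorμ (listTensor t f.list) (listTensor t Δ) U U' ≫ (f.map ⊗ₘ φ))
  have e : ((appendIso t f.list Γ).inv ≫ (𝟙 (listTensor t f.list) ⊗ₘ m) ≫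
      (appendIso t f.list Δ).hom) ▷ (U ⊗ U') ≫ (appendIso t f.list Δ).inv ▷ (U ⊗ U') ≫
      tensorμ (listTensor t f.list) (listTensor t Δ) U U' ≫ (f.map ⊗ₘ φ) =
      (appendIso t f.list Γ).inv ▷ (U ⊗ U') ≫
      tensorμ (listTensor t f.list) (listTensor t Γ) U U' ≫ (f.map ⊗ₘ m ▷ U' ≫ φ) := by
    simp only [comp_whiskerRight, Category.assoc, hom_inv_whiskerRight_assoc]
    rw [tensorμ_natural_left_assoc, tensorHom_comp_tensorHom, id_whiskerRight, Category.id_comp]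
  rw [e] at key
  exact key

instance : Congruence (permRel t) where
  equivalence := Relation.EqvGen.is_equivalence _
  comp_left f _ _ h := eqvGen_map (ListHom.comp f) (fun _ _ h => PermStep.comp_right f h) h
  comp_right g h := eqvGen_map (ListHom.comp · g) (fun _ _ h => PermStep.comp_left h g) h

/-- The quotient of the category of pairs `(Γ, φ)` by the action of the symmetric groups. -/
abbrev QuotCat (t : O → K) := CategoryTheory.Quotient (permRel t)

namespace QuotCat

/-- An object of `K` as an object of the quotient. -/
def of (t : O → K) (U : K) : QuotCat t := ⟨⟨U⟩⟩

/-- The quotient functor on morphisms. -/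
def cls {U V : K} (f : ListHom t U V) : of t U ⟶ of t V :=
  (CategoryTheory.Quotient.functor (permRel t)).map (X := ⟨U⟩) (Y := ⟨V⟩) f

/-- The composite embedding of `K` on morphisms. -/
def incl {U V : K} (f : U ⟶ V) : of t U ⟶ of t V := cls (ListHom.incl t f)

theorem exists_cls {U V : QuotCat t} (f : U ⟶ V) :
    ∃ g : ListHom t U.as.obj V.as.obj, f = cls g := by
  obtain ⟨g, rfl⟩ := (CategoryTheory.Quotient.functor (permRel t)).map_surjective
    (X := U.as) (Y := V.as) f
  exact ⟨g, rfl⟩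

theorem exists_ofIso {U V : QuotCat t} (f : U ⟶ V) :
    ∃ (A : K) (Γ : List O) (e : A ≅ listTensor t Γ) (φ : A ⊗ U.as.obj ⟶ V.as.obj),
      f = cls (ListHom.ofIso e φ) := by
  obtain ⟨g, rfl⟩ := exists_cls f
  obtain ⟨A, e, φ, h⟩ := ListHom.exists_ofIso g
  exact ⟨A, _, e, φ, congrArg cls h⟩

theorem cls_eq {U V : K} {f g : ListHom t U V} (h : Relation.EqvGen (PermStep t) f g) :
    cls f = cls g := CategoryTheory.Quotient.sound (permRel t) h

theorem cls_comp {U V W : K} (f : ListHom t U V) (g : ListHom t V W) :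
    cls f ≫ cls g = cls (f.comp g) := rfl

theorem incl_id (U : K) : incl (𝟙 U) = 𝟙 (of t U) := congrArg cls (ListHom.id_eq_incl U).symm

theorem incl_comp_incl {U V W : K} (f : U ⟶ V) (g : V ⟶ W) :
    (incl f : of t U ⟶ _) ≫ incl g = incl (f ≫ g) := congrArg cls (ListHom.incl_comp_incl f g)

/-- An isomorphism of `K` as an isomorphism of the quotient. -/
def inclIso {U V : K} (e : U ≅ V) : of t U ≅ of t V :=
  ⟨incl e.hom, incl e.inv, by rw [incl_comp_incl, e.hom_inv_id, incl_id],
    by rw [incl_comp_incl, e.inv_hom_id, incl_id]⟩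

/-- The tensor product of morphisms in the quotient. -/
def tensor {U V U' V' : QuotCat t} (f : U ⟶ V) (f' : U' ⟶ V') :
    of t (U.as.obj ⊗ U'.as.obj) ⟶ of t (V.as.obj ⊗ V'.as.obj) :=
  Quot.map₂ ListHom.tensor
    (fun f _ _ h => HomRel.CompClosure.of (r := permRel t)
      (eqvGen_map (ListHom.tensor f) (fun _ _ h => PermStep.tensor_right f h)
        ((HomRel.compClosure_iff_self (permRel t) _ _).1 h)))
    (fun _ _ g h => HomRel.CompClosure.of (r := permRel t)
      (eqvGen_map (ListHom.tensor · g) (fun _ _ h => PermStep.tensor_left h g)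
        ((HomRel.compClosure_iff_self (permRel t) _ _).1 h))) f f'

theorem tensor_cls {U V U' V' : K} (f : ListHom t U V) (f' : ListHom t U' V') :
    tensor (cls f) (cls f') = cls (f.tensor f') := rfl

/-- `m : A ⟶ B` is a canonical permutation map when `A` and `B` are identified with tensor products
of lists. -/
def Canon {A B : K} {Γ Δ : List O} (e : A ≅ listTensor t Γ) (e' : B ≅ listTensor t Δ)
    (m : A ⟶ B) : Prop :=
  ∃ σ : Fin Δ.length ≃ Fin Γ.length, IsPermMap t σ (e.inv ≫ m ≫ e'.hom)

section Canon

open ListHom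

variable {A B C A' B' : K} {Γ Δ Θ Γ' Δ' : List O} {e₁ : A ≅ listTensor t Γ}
  {e₂ : B ≅ listTensor t Δ} {e₃ : C ≅ listTensor t Θ} {e₁' : A' ≅ listTensor t Γ'}
  {e₂' : B' ≅ listTensor t Δ'}

theorem cls_canon {U V : K} {m : A ⟶ B} (h : Canon e₁ e₂ m) (φ : B ⊗ U ⟶ V) :
    cls (ofIso e₁ (m ▷ U ≫ φ)) = cls (ofIso e₂ φ) := by
  obtain ⟨σ, h⟩ := h
  refine (cls_eq (.rel _ _ ?_)).symm
  have key := PermStep.mk σ _ h (e₂.inv ▷ U ≫ φ)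
  have e : (e₁.inv ≫ m ≫ e₂.hom) ▷ U ≫ e₂.inv ▷ U ≫ φ = e₁.inv ▷ U ≫ m ▷ U ≫ φ := by simp
  rw [e] at key
  exact key

theorem Canon.of_cast {m : A ⟶ B} (h : Γ = Δ) (hm : e₁.hom ≫ listCast t h = m ≫ e₂.hom) :
    Canon e₁ e₂ m := by
  subst h
  refine ⟨Equiv.refl _, ?_⟩
  have : e₁.inv ≫ m ≫ e₂.hom = 𝟙 _ := by
    rw [← hm]; simp [listCast]
  rw [this]
  exact .id _

theorem Canon.comp {m : A ⟶ B} {m' : B ⟶ C} (h : Canon e₁ e₂ m) (h' : Canon e₂ e₃ m') :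
    Canon e₁ e₃ (m ≫ m') := by
  obtain ⟨σ, h⟩ := h
  obtain ⟨τ, h'⟩ := h'
  have := h.comp h'
  exact ⟨_, by simpa using this⟩

theorem Canon.tensor {m : A ⟶ B} {m' : A' ⟶ B'} (h : Canon e₁ e₂ m) (h' : Canon e₁' e₂' m') :
    Canon (cat e₁ e₁') (cat e₂ e₂') (m ⊗ₘ m') := by
  obtain ⟨σ, h⟩ := h
  obtain ⟨τ, h'⟩ := h'
  refine ⟨appendPerm σ τ, ?_⟩
  convert h.append h' using 1
  simp [cat]

theorem Canon.id (e : A ≅ listTensor t Γ) : Canon e e (𝟙 A) :=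
  Canon.of_cast rfl (by simp [listCast])

theorem Canon.whiskerLeft (e : C ≅ listTensor t Θ) {m : A ⟶ B} (h : Canon e₁ e₂ m) :
    Canon (cat e e₁) (cat e e₂) (C ◁ m) := by
  rw [← id_tensorHom]; exact (Canon.id e).tensor h

theorem Canon.whiskerRight (e : C ≅ listTensor t Θ) {m : A ⟶ B} (h : Canon e₁ e₂ m) :
    Canon (cat e₁ e) (cat e₂ e) (m ▷ C) := by
  rw [← tensorHom_id]; exact h.tensor (Canon.id e)

variable (e₁ e₂ e₃)

theorem Canon.braiding : Canon (cat e₁ e₂) (cat e₂ e₁) (β_ A B).hom := by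
  refine ⟨swapPerm Γ Δ, ?_⟩
  convert IsPermMap.swap (t := t) Γ Δ using 1
  simp [cat]

theorem Canon.assoc_hom : Canon (cat (cat e₁ e₂) e₃) (cat e₁ (cat e₂ e₃)) (α_ A B C).hom :=
  Canon.of_cast _ (cat_assoc e₁ e₂ e₃)

theorem Canon.assoc_inv : Canon (cat e₁ (cat e₂ e₃)) (cat (cat e₁ e₂) e₃) (α_ A B C).inv := by
  refine Canon.of_cast (List.append_assoc _ _ _).symm ?_
  rw [Iso.eq_inv_comp, ← Category.assoc, ← cat_assoc e₁ e₂ e₃]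
  simp [listCast]

theorem Canon.tensorμ (e₄ : A' ≅ listTensor t Γ') :
    Canon (cat (cat e₁ e₂) (cat e₃ e₄)) (cat (cat e₁ e₃) (cat e₂ e₄))
      (MonoidalCategory.tensorμ A B C A') :=
  (Canon.assoc_hom e₁ e₂ (cat e₃ e₄)).comp <|
    ((Canon.assoc_inv e₂ e₃ e₄).whiskerLeft e₁).comp <|
    (((Canon.braiding e₂ e₃).whiskerRight e₄).whiskerLeft e₁).comp <|
    ((Canon.assoc_hom e₃ e₂ e₄).whiskerLeft e₁).comp <|
    Canon.assoc_inv e₁ e₃ (cat e₂ e₄)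

end Canon

end QuotCat

end SMC

namespace SMC

variable {K : Type u₁} [Category.{v₁} K] [MonoidalCategory K] [SymmetricCategory K] {O : Type u}
  {t : O → K}

namespace QuotCat

open ListHom

theorem cls_comp_incl {U V W A : K} {Γ : List O} (e : A ≅ listTensor t Γ) (φ : A ⊗ U ⟶ V)
    (g : V ⟶ W) : cls (ofIso e φ) ≫ incl g = cls (ofIso e (φ ≫ g)) :=
  congrArg cls (comp_incl e φ g)

theorem incl_comp_cls {U V W A : K} {Γ : List O} (f : U ⟶ V) (e : A ≅ listTensor t Γ)
    (φ : A ⊗ V ⟶ W) : incl f ≫ cls (ofIso e φ) = cls (ofIso e (A ◁ f ≫ φ)) :=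
  congrArg cls (incl_comp f e φ)

theorem cls_comp_cls {U V W A B : K} {Γ Δ : List O} (e : A ≅ listTensor t Γ) (φ : A ⊗ U ⟶ V)
    (e' : B ≅ listTensor t Δ) (ψ : B ⊗ V ⟶ W) :
    cls (ofIso e φ) ≫ cls (ofIso e' ψ) =
      cls (ofIso (cat e' e) ((α_ B A U).hom ≫ B ◁ φ ≫ ψ)) :=
  congrArg cls (comp_ofIso e φ e' ψ)

theorem tensor_cls_cls {U V U' V' A A' : K} {Γ Γ' : List O} (e : A ≅ listTensor t Γ)
    (φ : A ⊗ U ⟶ V) (e' : A' ≅ listTensor t Γ') (φ' : A' ⊗ U' ⟶ V') :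
    tensor (cls (ofIso e φ)) (cls (ofIso e' φ')) =
      cls (ofIso (cat e e') (tensorμ A A' U U' ≫ (φ ⊗ₘ φ'))) :=
  congrArg cls (tensor_ofIso e φ e' φ')

theorem tensor_incl_incl {U V U' V' : K} (f : U ⟶ V) (g : U' ⟶ V') :
    tensor (incl f : of t U ⟶ _) (incl g : of t U' ⟶ _) = incl (f ⊗ₘ g) :=
  congrArg cls (incl_tensor_incl f g)

theorem id_eq_incl (U : QuotCat t) : 𝟙 U = (incl (𝟙 U.as.obj) : of t U.as.obj ⟶ of t U.as.obj) :=
  (incl_id U.as.obj).symm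

theorem tensor_id (U V : QuotCat t) :
    tensor (𝟙 U) (𝟙 V) = 𝟙 (of t (U.as.obj ⊗ V.as.obj)) := by
  rw [id_eq_incl, id_eq_incl]
  exact (tensor_incl_incl _ _).trans (by rw [id_tensorHom_id, incl_id])

theorem tensor_comp {U V W U' V' W' : QuotCat t} (f : U ⟶ V) (f' : U' ⟶ V') (g : V ⟶ W)
    (g' : V' ⟶ W') : tensor f f' ≫ tensor g g' = tensor (f ≫ g) (f' ≫ g') := by
  obtain ⟨A, Γ, e, φ, rfl⟩ := exists_ofIso f
  obtain ⟨A', Γ', e', φ', rfl⟩ := exists_ofIso f'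
  obtain ⟨B, Δ, d, ψ, rfl⟩ := exists_ofIso g
  obtain ⟨B', Δ', d', ψ', rfl⟩ := exists_ofIso g'
  erw [tensor_cls_cls, tensor_cls_cls, cls_comp_cls, cls_comp_cls, cls_comp_cls, tensor_cls_cls]
  rw [← cls_canon (Canon.tensorμ d d' e e')]
  congr 2
  have h : ((α_ B A U.as.obj).hom ≫ B ◁ φ ≫ ψ ⊗ₘ (α_ B' A' U'.as.obj).hom ≫ B' ◁ φ' ≫ ψ') =
      ((α_ B A U.as.obj).hom ⊗ₘ (α_ B' A' U'.as.obj).hom) ≫ (B ◁ φ ⊗ₘ B' ◁ φ') ≫ (ψ ⊗ₘ ψ') := by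
    simp only [tensorHom_comp_tensorHom]
  rw [h, tensor_associativity_assoc, whiskerLeft_comp, Category.assoc, tensorμ_natural_right_assoc]

theorem tensor_assoc {U V W U' V' W' : QuotCat t} (f : U ⟶ U') (g : V ⟶ V') (h : W ⟶ W') :
    tensor (tensor f g) h ≫ incl (α_ U'.as.obj V'.as.obj W'.as.obj).hom =
      incl (α_ U.as.obj V.as.obj W.as.obj).hom ≫ tensor f (tensor g h) := by
  obtain ⟨A, Γ, e, φ, rfl⟩ := exists_ofIso f
  obtain ⟨B, Δ, d, ψ, rfl⟩ := exists_ofIso g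
  obtain ⟨C, Θ, c, χ, rfl⟩ := exists_ofIso h
  have e1 := tensor_cls_cls e φ d ψ
  have e2 := tensor_cls_cls d ψ c χ
  have e3 := tensor_cls_cls (cat e d) (tensorμ A B U.as.obj V.as.obj ≫ (φ ⊗ₘ ψ)) c χ
  have e4 := tensor_cls_cls e φ (cat d c) (tensorμ B C V.as.obj W.as.obj ≫ (ψ ⊗ₘ χ))
  refine (congrArg (fun z => tensor z (cls (ofIso c χ)) ≫
    incl (α_ U'.as.obj V'.as.obj W'.as.obj).hom) e1).trans ?_
  refine Eq.trans ?_ (congrArg (fun z => incl (α_ U.as.obj V.as.obj W.as.obj).hom ≫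
    tensor (cls (ofIso e φ)) z) e2).symm
  refine (congrArg (· ≫ incl (α_ U'.as.obj V'.as.obj W'.as.obj).hom) e3).trans ?_
  refine Eq.trans ?_ (congrArg (incl (α_ U.as.obj V.as.obj W.as.obj).hom ≫ ·) e4).symm
  refine (cls_comp_incl _ _ _).trans (Eq.trans ?_ (incl_comp_cls _ _ _).symm)
  rw [← cls_canon (Canon.assoc_hom e d c)]
  congr 2
  have h1 : (tensorμ A B U.as.obj V.as.obj ≫ (φ ⊗ₘ ψ) ⊗ₘ χ) =
      tensorμ A B U.as.obj V.as.obj ▷ (C ⊗ W.as.obj) ≫ ((φ ⊗ₘ ψ) ⊗ₘ χ) := by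
    rw [← tensorHom_id, tensorHom_comp_tensorHom, Category.id_comp]
  have h2 : (φ ⊗ₘ tensorμ B C V.as.obj W.as.obj ≫ (ψ ⊗ₘ χ)) =
      (A ⊗ U.as.obj) ◁ tensorμ B C V.as.obj W.as.obj ≫ (φ ⊗ₘ (ψ ⊗ₘ χ)) := by
    rw [← id_tensorHom, tensorHom_comp_tensorHom, Category.id_comp]
  rw [h1, h2]
  simp only [Category.assoc]
  rw [associator_naturality, associator_monoidal_assoc, MonoidalCategory.tensorHom_def]
  simp only [Category.assoc]

theorem tensor_leftUnit {U V : QuotCat t} (f : U ⟶ V) :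
    tensor (𝟙 (of t (𝟙_ K))) f ≫ incl (λ_ V.as.obj).hom = incl (λ_ U.as.obj).hom ≫ f := by
  obtain ⟨A, Γ, e, φ, rfl⟩ := exists_ofIso f
  have h0 : 𝟙 (of t (𝟙_ K)) = cls (ofIso (nilIso t) (λ_ (𝟙_ K)).hom) :=
    congrArg cls (ListHom.id_eq (𝟙_ K))
  rw [h0]
  erw [tensor_cls_cls, cls_comp_incl, incl_comp_cls]
  rw [← cls_canon (Canon.of_cast (List.nil_append Γ) (nil_cat e))]
  congr 2
  have h1 : ((λ_ (𝟙_ K)).hom ⊗ₘ φ) = (λ_ (𝟙_ K)).hom ▷ _ ≫ 𝟙_ K ◁ φ :=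
    MonoidalCategory.tensorHom_def _ _
  have h2 : (λ_ A).hom ▷ (𝟙_ K ⊗ U.as.obj) ≫ A ◁ (λ_ U.as.obj).hom =
      ((λ_ A).hom ⊗ₘ (λ_ U.as.obj).hom) := (MonoidalCategory.tensorHom_def _ _).symm
  rw [h1, Category.assoc, Category.assoc, leftUnitor_naturality, reassoc_of% h2,
    leftUnitor_monoidal_assoc]

theorem tensor_rightUnit {U V : QuotCat t} (f : U ⟶ V) :
    tensor f (𝟙 (of t (𝟙_ K))) ≫ incl (ρ_ V.as.obj).hom = incl (ρ_ U.as.obj).hom ≫ f := by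
  obtain ⟨A, Γ, e, φ, rfl⟩ := exists_ofIso f
  have h0 : 𝟙 (of t (𝟙_ K)) = cls (ofIso (nilIso t) (λ_ (𝟙_ K)).hom) :=
    congrArg cls (ListHom.id_eq (𝟙_ K))
  rw [h0]
  erw [tensor_cls_cls, cls_comp_incl, incl_comp_cls]
  rw [← cls_canon (Canon.of_cast (List.append_nil Γ) (cat_nil e))]
  congr 2
  have h1 : (φ ⊗ₘ (λ_ (𝟙_ K)).hom) = _ ◁ (λ_ (𝟙_ K)).hom ≫ φ ▷ 𝟙_ K :=
    MonoidalCategory.tensorHom_def' _ _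
  have h2 : (ρ_ A).hom ▷ (U.as.obj ⊗ 𝟙_ K) ≫ A ◁ (ρ_ U.as.obj).hom =
      ((ρ_ A).hom ⊗ₘ (ρ_ U.as.obj).hom) := (MonoidalCategory.tensorHom_def _ _).symm
  rw [h1, Category.assoc, Category.assoc, rightUnitor_naturality, reassoc_of% h2,
    rightUnitor_monoidal_assoc]

instance : MonoidalCategoryStruct (QuotCat t) where
  tensorObj U V := of t (U.as.obj ⊗ V.as.obj)
  tensorUnit := of t (𝟙_ K)
  tensorHom f g := tensor f g
  whiskerLeft U _ _ g := tensor (𝟙 U) g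
  whiskerRight f V := tensor f (𝟙 V)
  associator U V W := inclIso (α_ U.as.obj V.as.obj W.as.obj)
  leftUnitor U := inclIso (λ_ U.as.obj)
  rightUnitor U := inclIso (ρ_ U.as.obj)

theorem incl_tensor_id {U V : K} (f : U ⟶ V) (W : QuotCat t) :
    tensor (incl f : of t U ⟶ _) (𝟙 W) = incl (f ▷ W.as.obj) := by
  rw [id_eq_incl]
  exact (tensor_incl_incl f (𝟙 W.as.obj)).trans (by rw [tensorHom_id])

theorem id_tensor_incl {U V : K} (f : U ⟶ V) (W : QuotCat t) :
    tensor (𝟙 W) (incl f : of t U ⟶ _) = incl (W.as.obj ◁ f) := by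
  rw [id_eq_incl]
  exact (tensor_incl_incl (𝟙 W.as.obj) f).trans (by rw [id_tensorHom])

instance : MonoidalCategory (QuotCat t) := MonoidalCategory.ofTensorHom
  (id_tensorHom_id := tensor_id)
  (id_tensorHom := fun _ _ _ _ => rfl)
  (tensorHom_id := fun _ _ => rfl)
  (tensorHom_comp_tensorHom := fun f f' g g' => tensor_comp f f' g g')
  (associator_naturality := tensor_assoc)
  (leftUnitor_naturality := tensor_leftUnit)
  (rightUnitor_naturality := tensor_rightUnit)
  (pentagon := fun W X Y Z => by
    change tensor (incl (α_ W.as.obj X.as.obj Y.as.obj).hom) (𝟙 Z) ≫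
      incl (α_ W.as.obj (X.as.obj ⊗ Y.as.obj) Z.as.obj).hom ≫
      tensor (𝟙 W) (incl (α_ X.as.obj Y.as.obj Z.as.obj).hom) =
      incl (α_ (W.as.obj ⊗ X.as.obj) Y.as.obj Z.as.obj).hom ≫
      incl (α_ W.as.obj X.as.obj (Y.as.obj ⊗ Z.as.obj)).hom
    rw [incl_tensor_id, id_tensor_incl]
    erw [incl_comp_incl, incl_comp_incl, incl_comp_incl]
    exact congrArg incl (MonoidalCategory.pentagon _ _ _ _))
  (triangle := fun X Y => by
    change incl (α_ X.as.obj (𝟙_ K) Y.as.obj).hom ≫ tensor (𝟙 X) (incl (λ_ Y.as.obj).hom) =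
      tensor (incl (ρ_ X.as.obj).hom) (𝟙 Y)
    rw [incl_tensor_id, id_tensor_incl]
    erw [incl_comp_incl]
    exact congrArg incl (MonoidalCategory.triangle _ _))

theorem tensorμ_braiding (A B U V : K) : tensorμ A B U V ≫ (β_ (A ⊗ U) (B ⊗ V)).hom =
      (β_ A B).hom ▷ _ ≫ _ ◁ (β_ U V).hom ≫ tensorμ B A V U := by
  have h0 : A ◁ (β_ B U).hom ▷ V ≫ A ◁ (β_ U B).hom ▷ V = 𝟙 _ := by
    rw [← whiskerLeft_comp, ← comp_whiskerRight, SymmetricCategory.symmetry]; simp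
  simp only [tensorμ, BraidedCategory.braiding_tensor_left_hom,
    BraidedCategory.braiding_tensor_right_hom, whiskerLeft_comp, comp_whiskerRight, Category.assoc]
  have h1 : A ◁ (α_ U B V).hom ≫ (α_ A U (B ⊗ V)).inv ≫ (α_ (A ⊗ U) B V).inv ≫
      (α_ A U B).hom ▷ V ≫ (A ◁ (β_ U B).hom) ▷ V =
      A ◁ (β_ U B).hom ▷ V ≫ (α_ A (B ⊗ U) V).inv := by monoidal
  rw [reassoc_of% h1, reassoc_of% h0]
  monoidal

theorem tensor_braiding {U V U' V' : QuotCat t} (f : U ⟶ U') (g : V ⟶ V') :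
    tensor f g ≫ incl (β_ U'.as.obj V'.as.obj).hom =
      incl (β_ U.as.obj V.as.obj).hom ≫ tensor g f := by
  obtain ⟨A, Γ, e, φ, rfl⟩ := exists_ofIso f
  obtain ⟨B, Δ, d, ψ, rfl⟩ := exists_ofIso g
  erw [tensor_cls_cls, tensor_cls_cls, cls_comp_incl, incl_comp_cls]
  rw [← cls_canon (Canon.braiding e d)]
  congr 2
  have h := tensorμ_braiding A B U.as.obj V.as.obj
  rw [Category.assoc, BraidedCategory.braiding_naturality, reassoc_of% h]

instance : SymmetricCategory (QuotCat t) where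
  braiding U V := inclIso (β_ U.as.obj V.as.obj)
  braiding_naturality_right X _ _ f := tensor_braiding (𝟙 X) f
  braiding_naturality_left f Z := tensor_braiding f (𝟙 Z)
  hexagon_forward X Y Z := by
    change incl (α_ X.as.obj Y.as.obj Z.as.obj).hom ≫ incl (β_ X.as.obj (Y.as.obj ⊗ Z.as.obj)).hom ≫
      incl (α_ Y.as.obj Z.as.obj X.as.obj).hom = tensor (incl (β_ X.as.obj Y.as.obj).hom) (𝟙 Z) ≫
      incl (α_ Y.as.obj X.as.obj Z.as.obj).hom ≫ tensor (𝟙 Y) (incl (β_ X.as.obj Z.as.obj).hom)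
    rw [incl_tensor_id, id_tensor_incl]
    erw [incl_comp_incl, incl_comp_incl, incl_comp_incl, incl_comp_incl]
    exact congrArg incl (BraidedCategory.hexagon_forward _ _ _)
  hexagon_reverse X Y Z := by
    change incl (α_ X.as.obj Y.as.obj Z.as.obj).inv ≫ incl (β_ (X.as.obj ⊗ Y.as.obj) Z.as.obj).hom ≫
      incl (α_ Z.as.obj X.as.obj Y.as.obj).inv = tensor (𝟙 X) (incl (β_ Y.as.obj Z.as.obj).hom) ≫
      incl (α_ X.as.obj Z.as.obj Y.as.obj).inv ≫ tensor (incl (β_ X.as.obj Z.as.obj).hom) (𝟙 Y)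
    rw [incl_tensor_id, id_tensor_incl]
    erw [incl_comp_incl, incl_comp_incl, incl_comp_incl, incl_comp_incl]
    exact congrArg incl (BraidedCategory.hexagon_reverse _ _ _)
  symmetry X Y := by
    change incl (β_ X.as.obj Y.as.obj).hom ≫ incl (β_ Y.as.obj X.as.obj).hom = _
    rw [incl_comp_incl, SymmetricCategory.symmetry, incl_id]
    rfl

end QuotCat

end SMC

namespace SMC

variable {K : Type u₁} [Category.{v₁} K] [MonoidalCategory K] [SymmetricCategory K] {O : Type u}
  {t : O → K}

/-- The canonical isomorphism. -/
def shuffle (A G U : K) : A ⊗ (G ⊗ U) ≅ G ⊗ (A ⊗ U) :=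
  (α_ A G U).symm ≪≫ whiskerRightIso (β_ A G) U ≪≫ α_ G A U

theorem shuffle_natural_left (A : K) {G G' : K} (m : G ⟶ G') (U : K) :
    A ◁ (m ▷ U) ≫ (shuffle A G' U).hom = (shuffle A G U).hom ≫ m ▷ (A ⊗ U) := by
  have h : A ◁ m ▷ U ≫ (α_ A G' U).inv ≫ (β_ A G').hom ▷ U =
      (α_ A G U).inv ≫ (β_ A G).hom ▷ U ≫ m ▷ A ▷ U := by
    rw [← comp_whiskerRight, ← BraidedCategory.braiding_naturality_right, comp_whiskerRight,
      associator_inv_naturality_middle_assoc]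
  simp only [shuffle, Iso.trans_hom, Iso.symm_hom, whiskerRightIso_hom, Category.assoc,
    reassoc_of% h]
  simp

theorem shuffle_natural_right (A G : K) {U V : K} (f : U ⟶ V) :
    A ◁ (G ◁ f) ≫ (shuffle A G V).hom = (shuffle A G U).hom ≫ G ◁ (A ◁ f) := by
  simp only [shuffle, Iso.trans_hom, Iso.symm_hom, whiskerRightIso_hom, Category.assoc]
  rw [associator_inv_naturality_right_assoc, whisker_exchange_assoc, associator_naturality_right]

theorem shuffle_tensor (A B G U : K) :
    (shuffle A (B ⊗ G) U).hom ≫ (α_ B G (A ⊗ U)).hom ≫ B ◁ (shuffle A G U).inv =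
      A ◁ (α_ B G U).hom ≫ (shuffle A B (G ⊗ U)).hom := by
  simp only [shuffle, Iso.trans_hom, Iso.symm_hom, whiskerRightIso_hom, Category.assoc,
    Iso.trans_inv, Iso.symm_inv, whiskerRightIso_inv, BraidedCategory.braiding_tensor_right_hom,
    whiskerLeft_comp, comp_whiskerRight]
  have h : (B ◁ (β_ A G).hom) ▷ U ≫ (α_ B G A).inv ▷ U ≫ (α_ (B ⊗ G) A U).hom ≫
      (α_ B G (A ⊗ U)).hom ≫ B ◁ (α_ G A U).inv ≫ B ◁ (β_ A G).inv ▷ U ≫ B ◁ (α_ A G U).hom =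
      (α_ B (A ⊗ G) U).hom ≫ B ◁ (α_ A G U).hom := by
    have h0 : B ◁ (β_ A G).hom ▷ U ≫ B ◁ (β_ A G).inv ▷ U = 𝟙 _ := by
      rw [← whiskerLeft_comp, ← comp_whiskerRight]; simp
    have h1 : (B ◁ (β_ A G).hom) ▷ U ≫ (α_ B G A).inv ▷ U ≫ (α_ (B ⊗ G) A U).hom ≫
      (α_ B G (A ⊗ U)).hom ≫ B ◁ (α_ G A U).inv =
      (α_ B (A ⊗ G) U).hom ≫ B ◁ (β_ A G).hom ▷ U := by monoidal
    rw [reassoc_of% h1, reassoc_of% h0]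
  rw [h]
  monoidal

theorem tensorμ_unit (G A U : K) :
    tensorμ (𝟙_ K) G A U ≫ (λ_ A).hom ▷ (G ⊗ U) =
      (λ_ G).hom ▷ (A ⊗ U) ≫ (shuffle A G U).inv := by
  simp only [shuffle, tensorμ, Category.assoc, Iso.trans_inv, Iso.symm_inv, whiskerRightIso_inv]
  rw [← SymmetricCategory.braiding_swap_eq_inv_braiding]
  monoidal

theorem curry_shuffle_comp [MonoidalClosed K] {A B G U V W : K} (φ : G ⊗ U ⟶ V)
    (ψ : B ⊗ (A ⊗ V) ⟶ W) :
    MonoidalClosed.curry ((shuffle A (B ⊗ G) U).hom ≫ (α_ B G (A ⊗ U)).hom ≫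
      B ◁ ((shuffle A G U).inv ≫ A ◁ φ) ≫ ψ) =
    (α_ B G U).hom ≫ B ◁ φ ≫ MonoidalClosed.curry ((shuffle A B V).hom ≫ ψ) := by
  have h := shuffle_tensor A B G U
  have h' := shuffle_natural_right A B φ
  rw [← MonoidalClosed.curry_natural_left, ← MonoidalClosed.curry_natural_left,
    whiskerLeft_comp, Category.assoc, reassoc_of% h, reassoc_of% h']

namespace ListHom

variable [MonoidalClosed K]

/-- The bijection sending `(Γ, φ)`, where `φ : listTensor t Γ ⊗ (A ⊗ U) ⟶ W`, to `(Γ, φ')`, where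
`φ' : listTensor t Γ ⊗ U ⟶ A ⊸ W` is the transpose of `φ`. -/
def curry (A : K) {U W : K} (f : ListHom t (A ⊗ U) W) : ListHom t U (lolli A W) :=
  ⟨f.list, MonoidalClosed.curry ((shuffle A (listTensor t f.list) U).hom ≫ f.map)⟩

/-- The inverse of `curry`. -/
def uncurry (A : K) {U W : K} (f : ListHom t U (lolli A W)) : ListHom t (A ⊗ U) W :=
  ⟨f.list, (shuffle A (listTensor t f.list) U).inv ≫ MonoidalClosed.uncurry f.map⟩

theorem uncurry_curry (A : K) {U W : K} (f : ListHom t (A ⊗ U) W) : uncurry A (curry A f) = f := by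
  refine congrArg (ListHom.mk f.list) ?_
  exact (congrArg ((shuffle A (listTensor t f.list) U).inv ≫ ·)
    (MonoidalClosed.uncurry_curry _)).trans (Iso.inv_hom_id_assoc _ _)

theorem curry_uncurry (A : K) {U W : K} (f : ListHom t U (lolli A W)) :
    curry A (uncurry A f) = f := by
  refine congrArg (ListHom.mk f.list) ?_
  exact (congrArg MonoidalClosed.curry (Iso.hom_inv_id_assoc _ _)).trans
    (MonoidalClosed.curry_uncurry _)

theorem curry_ofIso (A : K) {U W G : K} {Γ : List O} (e : G ≅ listTensor t Γ)
    (φ : G ⊗ (A ⊗ U) ⟶ W) :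
    curry A (ofIso e φ) = ofIso e (MonoidalClosed.curry ((shuffle A G U).hom ≫ φ)) := by
  refine congrArg (ListHom.mk Γ) ?_
  rw [← MonoidalClosed.curry_natural_left]
  refine congrArg MonoidalClosed.curry ?_
  change (shuffle A (listTensor t Γ) U).hom ≫ e.inv ▷ (A ⊗ U) ≫ φ = _
  rw [← Category.assoc, ← shuffle_natural_left, Category.assoc]

end ListHom

theorem PermStep.curry [MonoidalClosed K] (A : K) {U W : K} {f f' : ListHom t (A ⊗ U) W}
    (h : PermStep t f f') : PermStep t (f.curry A) (f'.curry A) := by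
  obtain @⟨Γ, Δ, σ, m, h, φ⟩ := h
  have key := PermStep.mk _ _ h (MonoidalClosed.curry ((shuffle A (listTensor t Δ) U).hom ≫ φ))
  rw [← MonoidalClosed.curry_natural_left, ← Category.assoc (A ◁ m ▷ U), shuffle_natural_left,
    Category.assoc] at key
  exact key

theorem PermStep.uncurry [MonoidalClosed K] (A : K) {U W : K} {f f' : ListHom t U (lolli A W)}
    (h : PermStep t f f') : PermStep t (f.uncurry A) (f'.uncurry A) := by
  obtain @⟨Γ, Δ, σ, m, h, φ⟩ := h
  have key := PermStep.mk _ _ h ((shuffle A (listTensor t Δ) U).inv ≫ MonoidalClosed.uncurry φ)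
  have e : m ▷ (A ⊗ U) ≫ (shuffle A (listTensor t Δ) U).inv ≫ MonoidalClosed.uncurry φ =
      (shuffle A (listTensor t Γ) U).inv ≫ MonoidalClosed.uncurry (m ▷ U ≫ φ) := by
    rw [MonoidalClosed.uncurry_natural_left, Iso.eq_inv_comp, ← Category.assoc,
      ← shuffle_natural_left, Category.assoc, Iso.hom_inv_id_assoc]
  rw [e] at key
  exact key

namespace QuotCat

open ListHom

theorem id_tensor_cls (A : K) {U V G : K} {Γ : List O} (e : G ≅ listTensor t Γ)
    (φ : G ⊗ U ⟶ V) :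
    of t A ◁ cls (ofIso e φ) = cls (ofIso e ((shuffle A G U).inv ≫ A ◁ φ)) := by
  have h0 : 𝟙 (of t A) = cls (ofIso (nilIso t) (λ_ A).hom) := congrArg cls (ListHom.id_eq A)
  refine (congrArg (fun z => tensor z (cls (ofIso e φ))) h0).trans ?_
  refine (tensor_cls_cls (nilIso t) (λ_ A).hom e φ).trans ?_
  rw [← cls_canon (Canon.of_cast (List.nil_append Γ) (nil_cat e))]
  congr 2
  rw [MonoidalCategory.tensorHom_def, ← Category.assoc, tensorμ_unit, Category.assoc]

variable [MonoidalClosed K]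

/-- The bijection induced by `ListHom.curry`. -/
def homEquiv (A U W : QuotCat t) :
    (A ⊗ U ⟶ W) ≃ (U ⟶ of t (lolli A.as.obj W.as.obj)) where
  toFun := Quot.map (ListHom.curry A.as.obj) (fun _ _ h => HomRel.CompClosure.of (r := permRel t)
    (eqvGen_map (ListHom.curry A.as.obj) (fun _ _ h => PermStep.curry A.as.obj h)
      ((HomRel.compClosure_iff_self (permRel t) _ _).1 h)))
  invFun := Quot.map (ListHom.uncurry A.as.obj) (fun _ _ h =>
    HomRel.CompClosure.of (r := permRel t)
    (eqvGen_map (ListHom.uncurry A.as.obj) (fun _ _ h => PermStep.uncurry A.as.obj h)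
      ((HomRel.compClosure_iff_self (permRel t) _ _).1 h)))
  left_inv f := by
    obtain ⟨f, rfl⟩ := exists_cls f
    exact congrArg cls (ListHom.uncurry_curry A.as.obj f)
  right_inv f := by
    obtain ⟨f, rfl⟩ := exists_cls f
    exact congrArg cls (ListHom.curry_uncurry A.as.obj f)

theorem homEquiv_cls {A U W G : K} {Γ : List O} (e : G ≅ listTensor t Γ)
    (φ : G ⊗ (A ⊗ U) ⟶ W) :
    homEquiv (of t A) (of t U) (of t W) (cls (ofIso e φ)) =
      cls (ofIso e (MonoidalClosed.curry ((shuffle A G U).hom ≫ φ))) :=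
  congrArg cls (ListHom.curry_ofIso A e φ)

theorem homEquiv_naturality (A U V W : QuotCat t) (f : U ⟶ V) (g : A ⊗ V ⟶ W) :
    homEquiv A U W (A ◁ f ≫ g) = f ≫ homEquiv A V W g := by
  obtain ⟨G, Γ, e, φ, rfl⟩ := exists_ofIso f
  obtain ⟨B, Δ, d, ψ, rfl⟩ := exists_ofIso g
  refine (congrArg (fun z => homEquiv A U W (z ≫ cls (ofIso d ψ)))
    (id_tensor_cls A.as.obj e φ)).trans ?_
  refine (congrArg (homEquiv A U W) (cls_comp_cls e _ d ψ)).trans ?_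
  refine (homEquiv_cls _ _).trans ?_
  refine Eq.trans ?_ (congrArg (cls (ofIso e φ) ≫ ·) (homEquiv_cls d ψ)).symm
  refine Eq.trans ?_ (cls_comp_cls e φ d _).symm
  exact congrArg (fun z => cls (ofIso (cat d e) z)) (curry_shuffle_comp φ ψ)

instance : MonoidalClosed (QuotCat t) where
  closed A :=
    { rightAdj := Adjunction.rightAdjointOfEquiv (F := tensorLeft A) (homEquiv A)
        (homEquiv_naturality A)
      adj := Adjunction.adjunctionOfEquivRight (F := tensorLeft A) (homEquiv A)
        (homEquiv_naturality A) }

end QuotCat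

end SMC

namespace SMC

/-- The signature with ground types `X` and no ground terms. -/
def emptySignature (X : Type u) : Signature.{u} where
  X := X
  Op := PEmpty
  src f := f.elim
  tgt f := f.elim

/-- The free symmetric monoidal closed category on a set `X`. -/
abbrev FreeCat (X : Type u) := SynCat (emptySignature X).free

namespace Signature

variable (S : Signature.{u})

/-- A type over the ground types of the signature as an object of the free category. -/
def ofTy (a : Ty S.X) : FreeCat S.X := ⟨a⟩

/-- The typing function on ground terms, `ty α = s α ⊸ t α`. Its extension to lists is
`listTensor S.opTy`. -/
def opTy (α : S.Op) : FreeCat S.X := lolli (S.ofTy (S.src α)) (S.ofTy (S.tgt α))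

/-- The category with the objects of the free category on `X`, and with morphisms from `U` to `V`
the pairs of a list `Γ` of ground terms and a morphism `ty Γ ⊗ U ⟶ V` of the free category. -/
abbrev PreCat := ListCat S.opTy

/-- The quotient of `S.PreCat` by the action of the symmetric groups on lists. -/
abbrev CohCat := QuotCat S.opTy

/-- A type over the ground types of the signature as an object of the quotient. -/
def cohTy (a : Ty S.X) : S.CohCat := QuotCat.of S.opTy (S.ofTy a)

/-- The morphism `[α] : s α ⟶ t α` represented by the pair `((α), ε)`. -/
def gen (α : S.Op) : S.cohTy (S.src α) ⟶ S.cohTy (S.tgt α) :=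
  QuotCat.cls ⟨[α], eval (S.ofTy (S.src α)) (S.ofTy (S.tgt α))⟩

variable {D : Type u₁} [Category.{v₁} D] [MonoidalCategory D] [SymmetricCategory D]
  [MonoidalClosed D]

/-- The object of the quotient given by a type is the interpretation of that type at the ground
types. -/
theorem cohTy_eq (a : Ty S.X) : S.cohTy a = Ty.interp (fun x => S.cohTy (.var x)) a := by
  induction a with
  | var x => rfl
  | unit => rfl
  | tensor a b iha ihb =>
    exact (rfl : S.cohTy (.tensor a b) = S.cohTy a ⊗ S.cohTy b).trans
      (congrArg₂ (fun c d => c ⊗ d) iha ihb)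
  | lolli a b iha ihb =>
    exact (rfl : S.cohTy (.lolli a b) = SMC.lolli (S.cohTy a) (S.cohTy b)).trans
      (congrArg₂ SMC.lolli iha ihb)

/-- The value of a strict functor at a type is the interpretation of that type determined by the
values at the ground types. -/
theorem obj_cohTy (F : StrictFunctor S.CohCat D) (a : Ty S.X) :
    F.functor.obj (S.cohTy a) = Ty.interp (fun x => F.functor.obj (S.cohTy (.var x))) a :=
  (congrArg F.functor.obj (S.cohTy_eq a)).trans (F.obj_interp _ a)

end Signature

/-- The interpretation `G` determined by a strict functor `F`: `G x = F x` for a ground type `x`,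
and `G α = F [α] : F (s α) ⟶ F (t α)` for a ground term `α`. -/
def StrictFunctor.toInterpretation {S : Signature.{u}} {D : Type u₁} [Category.{v₁} D]
    [MonoidalCategory D] [SymmetricCategory D] [MonoidalClosed D]
    (F : StrictFunctor S.CohCat D) : Interpretation S.free D where
  obj x := F.functor.obj (S.cohTy (.var x))
  op α := eqToHom (S.obj_cohTy F (S.src α)).symm ≫ F.functor.map (S.gen α) ≫
    eqToHom (S.obj_cohTy F (S.tgt α))
  sat _ _ h := h.elim

end SMC

/-! A closed structure makes a morphism `f : a ⟶ b` the same thing as a point `name f : I ⟶ a ⊸ b`.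
A morphism of the classifying category is a pair `(Γ, φ)` with `φ : ty Γ ⊗ U ⟶ V` in the free
category on `X`. So it is a structural map with one free slot of type `s α ⊸ t α` for each entry `α`
of `Γ`.

Existence. Let `G` be an interpretation in `D`. Its ground types give a strict functor out of the
free category, because the interpretation of derived terms respects the congruence
(`TermEq.interp_eq`). Its ground terms give the points `name (G α)`, and tensoring these along `Γ`
gives a point of the image of `ty Γ`. Send `(Γ, φ)` to the partial evaluation `U ≅ I ⊗ U ⟶ ty Γ ⊗ U
⟶ V` of the image of `φ` at this point. Composition is respected by the interchange law and
multiplicativity of the points (`evalPoint_comp`, `listPoint_append`). The relation `∼` is respected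
because permutation maps carry points to points: the symmetry of `I ⊗ I` is the identity
(`pairPoint_braiding`, `listPoint_isPermMap`). The class `[α] = ((α), ε)` goes to `ε` evaluated at
`name (G α)`, which is `G α`.

Strictness. The associativity, unit and symmetry maps and `ε` of the quotient are images of those of
the free category (for `ε` this is `incl_eval`), and there the functor is already strict. The tensor
product is handled by `evalPoint_tensor`. The internal hom of morphisms and `η` are determined by
equations in `ε` and `⊗` (`eq_lolliMap`, `eq_coeval`), so any functor strict for the latter two is
strict for the former.

Uniqueness. The morphisms `[α]` generate. A pair splits as a composite of pairs with one-element
lists (`cls_append`) and pairs with empty list, which lie in the free category. A pair `((α), φ)` is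
a structural composite involving the point of `α` (`cls_eq_point`), and that point is `name [α]`
(`opName_eq`). Hence two strict functors with the same interpretation agree. -/

namespace SMC

/-! ### Monoidal axioms in the form of the congruence: identities tensored, not whiskered. -/

section Coherence

variable {D : Type u₁} [Category.{v₁} D] [MonoidalCategory D]

theorem pentagon_tensorHom (a b c d : D) :
    ((α_ a b c).hom ⊗ₘ 𝟙 d) ≫ (α_ a (b ⊗ c) d).hom ≫ (𝟙 a ⊗ₘ (α_ b c d).hom) =
      (α_ (a ⊗ b) c d).hom ≫ (α_ a b (c ⊗ d)).hom := by
  simp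

theorem triangle_tensorHom (a b : D) :
    (α_ a (𝟙_ D) b).hom ≫ (𝟙 a ⊗ₘ (λ_ b).hom) = (ρ_ a).hom ⊗ₘ 𝟙 b := by
  simp

theorem hexagon_tensorHom [SymmetricCategory D] (a b c : D) :
    (α_ a b c).hom ≫ (β_ a (b ⊗ c)).hom ≫ (α_ b c a).hom =
      ((β_ a b).hom ⊗ₘ 𝟙 c) ≫ (α_ b a c).hom ≫ (𝟙 b ⊗ₘ (β_ a c).hom) := by
  simp

end Coherence

/-! ### Calculus of `ε` and `η`, and soundness of the interpretation of derived terms. -/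

section Closed

variable {D : Type u₁} [Category.{v₁} D] [MonoidalCategory D] [SymmetricCategory D]
  [MonoidalClosed D]

/-- Translates between the right-handed counit used here and the left-handed transposition of
`MonoidalClosed`: they differ by a symmetry. -/
theorem whiskerRight_eval {a b x : D} (h : x ⟶ lolli a b) :
    h ▷ a ≫ eval a b = (β_ x a).hom ≫ MonoidalClosed.uncurry h := by
  rw [eval, BraidedCategory.braiding_naturality_left_assoc, MonoidalClosed.uncurry_eq]

/-- Transposition is injective and the symmetry is invertible. All later equations between maps into
an internal hom are proved by testing against `ε`. -/
theorem eval_ext {a b x : D} {h h' : x ⟶ lolli a b}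
    (e : h ▷ a ≫ eval a b = h' ▷ a ≫ eval a b) : h = h' := by
  rw [whiskerRight_eval, whiskerRight_eval, cancel_epi] at e
  exact MonoidalClosed.uncurry_injective e

/-- Naturality and dinaturality of `ε` in one equation; by `eval_ext` it characterises `lolliMap f
g`. -/
theorem lolliMap_eval {a b c d : D} (f : a ⟶ b) (g : c ⟶ d) :
    lolliMap f g ▷ a ≫ eval a d = lolli b c ◁ f ≫ eval b c ≫ g := by
  rw [whiskerRight_eval, lolliMap, MonoidalClosed.uncurry_natural_right,
    MonoidalClosed.uncurry_pre, eval, Category.assoc, Category.assoc,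
    BraidedCategory.braiding_naturality_right_assoc]

theorem lolliMap_id_eval (a : D) {c d : D} (g : c ⟶ d) :
    lolliMap (𝟙 a) g ▷ a ≫ eval a d = eval a c ≫ g := by
  simp [lolliMap_eval]

/-- The unit is the transpose of an identity up to a symmetry, and the symmetry inside `eval`
cancels the one inside `coeval`. -/
theorem coeval_eval (a b : D) : coeval a b ▷ b ≫ eval b (a ⊗ b) = 𝟙 _ := by
  rw [whiskerRight_eval, coeval, MonoidalClosed.uncurry_natural_right,
    ← MonoidalClosed.curry_id_eq_coev, MonoidalClosed.uncurry_curry]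
  simp

theorem coeval_eval_assoc (a b : D) {c : D} (h : a ⊗ b ⟶ c) :
    coeval a b ▷ b ≫ eval b (a ⊗ b) ≫ h = h := by
  rw [← Category.assoc, coeval_eval, Category.id_comp]

theorem lolliMap_eval_assoc {a b c d e : D} (f : a ⟶ b) (g : c ⟶ d) (h : d ⟶ e) :
    lolliMap f g ▷ a ≫ eval a d ≫ h = lolli b c ◁ f ≫ eval b c ≫ g ≫ h := by
  rw [← Category.assoc, lolliMap_eval, Category.assoc, Category.assoc]

theorem lolliMap_id (a b : D) : lolliMap (𝟙 a) (𝟙 b) = 𝟙 (lolli a b) :=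
  eval_ext (by simp [lolliMap_eval])

theorem lolliMap_comp {a b c a' b' c' : D} (f : a ⟶ b) (g : b ⟶ c) (f' : a' ⟶ b')
    (g' : b' ⟶ c') : lolliMap (f ≫ g) (f' ≫ g') = lolliMap g f' ≫ lolliMap f g' := by
  refine eval_ext ?_
  rw [lolliMap_eval, comp_whiskerRight, Category.assoc, lolliMap_eval,
    ← whisker_exchange_assoc, lolliMap_eval_assoc, whiskerLeft_comp, Category.assoc]

theorem coeval_naturality {a a' : D} (f : a ⟶ a') (b : D) :
    f ≫ coeval a' b = coeval a b ≫ lolliMap (𝟙 b) (f ▷ b) := by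
  refine eval_ext ?_
  rw [comp_whiskerRight, comp_whiskerRight, Category.assoc, Category.assoc, coeval_eval,
    lolliMap_id_eval, coeval_eval_assoc, Category.comp_id]

/-- Tested against `ε`, both sides become `a ◁ g`. -/
theorem coeval_dinaturality (a : D) {b b' : D} (g : b ⟶ b') :
    coeval a b ≫ lolliMap (𝟙 b) (a ◁ g) = coeval a b' ≫ lolliMap g (𝟙 (a ⊗ b')) := by
  refine eval_ext ?_
  rw [comp_whiskerRight, comp_whiskerRight, Category.assoc, Category.assoc,
    lolliMap_id_eval, coeval_eval_assoc, lolliMap_eval, ← whisker_exchange_assoc,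
    coeval_eval_assoc, Category.comp_id]

theorem coeval_lolliMap_eval (a b : D) :
    coeval (lolli a b) a ≫ lolliMap (𝟙 a) (eval a b) = 𝟙 _ := by
  refine eval_ext ?_
  rw [comp_whiskerRight, Category.assoc, lolliMap_id_eval, coeval_eval_assoc, id_whiskerRight,
    Category.id_comp]

/-- The interpretation of derived terms is sound for provable equality. -/
theorem TermEq.interp_eq {T : Theory.{u}} (G : Interpretation T D) {a b : Ty T.X}
    {p q : Term T.toSignature a b} (h : TermEq T p q) :
    Term.interp G.op p = Term.interp G.op q := by
  induction h with
  | refl => rfl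
  | symm _ ih => exact ih.symm
  | trans _ _ ih ih' => exact ih.trans ih'
  | comp_congr _ _ ih ih' => exact congrArg₂ (· ≫ ·) ih ih'
  | tensor_congr _ _ ih ih' => exact congrArg₂ (· ⊗ₘ ·) ih ih'
  | lolli_congr _ _ ih ih' => exact congrArg₂ lolliMap ih ih'
  | eqn h => exact G.sat _ _ h
  | id_comp => exact Category.id_comp _
  | comp_id => exact Category.comp_id _
  | comp_assoc => exact Category.assoc _ _ _
  | tensor_id => exact id_tensorHom_id _ _
  | tensor_comp => exact (tensorHom_comp_tensorHom _ _ _ _).symm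
  | lolli_id => exact lolliMap_id _ _
  | lolli_comp => exact lolliMap_comp _ _ _ _
  | assoc_naturality => exact associator_inv_naturality _ _ _
  | leftUnit_naturality =>
    exact (congrArg (· ≫ _) (id_tensorHom _ _)).trans (leftUnitor_naturality _)
  | rightUnit_naturality =>
    exact (congrArg (· ≫ _) (tensorHom_id _ _)).trans (rightUnitor_naturality _)
  | symm_naturality => exact BraidedCategory.braiding_naturality _ _
  | eval_naturality a g =>
    exact (congrArg (· ≫ _) (tensorHom_id _ _)).trans (lolliMap_id_eval _ _)
  | eval_dinaturality f b =>
    refine (congrArg (· ≫ _) (tensorHom_id _ _)).trans ((lolliMap_eval _ _).trans ?_)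
    exact congrArg₂ (· ≫ ·) (id_tensorHom _ _).symm (Category.comp_id _)
  | coeval_naturality f b =>
    exact (SMC.coeval_naturality _ _).trans
      (congrArg (fun z => _ ≫ lolliMap _ z) (tensorHom_id _ _).symm)
  | coeval_dinaturality a g =>
    exact (congrArg (fun z => _ ≫ lolliMap _ z) (id_tensorHom _ _)).trans
      (SMC.coeval_dinaturality _ _)
  -- The term `.assoc` goes from `a ⊗ (b ⊗ c)` to `(a ⊗ b) ⊗ c`, so its interpretation is the
  -- inverse associator and the two inverse laws change places.
  | assoc_hom_inv => exact (α_ _ _ _).inv_hom_id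
  | assoc_inv_hom => exact (α_ _ _ _).hom_inv_id
  | leftUnit_hom_inv => exact (λ_ _).hom_inv_id
  | leftUnit_inv_hom => exact (λ_ _).inv_hom_id
  | rightUnit_hom_inv => exact (ρ_ _).hom_inv_id
  | rightUnit_inv_hom => exact (ρ_ _).inv_hom_id
  | triangle_left =>
    exact (congrArg (· ≫ _) (tensorHom_id _ _)).trans (coeval_eval _ _)
  | triangle_right => exact coeval_lolliMap_eval _ _
  | pentagon => exact pentagon_tensorHom _ _ _ _
  | triangle => exact triangle_tensorHom _ _
  | hexagon => exact hexagon_tensorHom _ _ _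
  | symm_symm => exact SymmetricCategory.symmetry _ _

/-- The functor out of the category of derived terms determined by an interpretation. -/
def Interpretation.synFunctor {T : Theory.{u}} (G : Interpretation T D) : SynCat T ⥤ D where
  obj a := Ty.interp G.obj a.ty
  map f := Quotient.lift (Term.interp G.op) (fun _ _ h => TermEq.interp_eq G h) f
  map_id _ := rfl
  map_comp f g := by
    obtain ⟨f, rfl⟩ := SynCat.cls_surj f
    obtain ⟨g, rfl⟩ := SynCat.cls_surj g
    rfl

namespace Interpretation

variable {T : Theory.{u}} (G : Interpretation T D)

/-- Tensor products of objects are preserved definitionally, so strictness is an ordinary equation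
and can be checked on representing terms. -/
theorem synFunctor_tensor {a b c d : SynCat T} (f : a ⟶ b) (g : c ⟶ d) :
    G.synFunctor.map (f ⊗ₘ g) = G.synFunctor.map f ⊗ₘ G.synFunctor.map g := by
  obtain ⟨f, rfl⟩ := SynCat.cls_surj f
  obtain ⟨g, rfl⟩ := SynCat.cls_surj g
  rfl

theorem synFunctor_whiskerRight {a b : SynCat T} (f : a ⟶ b) (c : SynCat T) :
    G.synFunctor.map (f ▷ c) = G.synFunctor.map f ▷ G.synFunctor.obj c :=
  (G.synFunctor_tensor f (𝟙 c)).trans (tensorHom_id _ _)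

theorem synFunctor_whiskerLeft (c : SynCat T) {a b : SynCat T} (f : a ⟶ b) :
    G.synFunctor.map (c ◁ f) = G.synFunctor.obj c ◁ G.synFunctor.map f :=
  (G.synFunctor_tensor (𝟙 c) f).trans (id_tensorHom _ _)

/-- The adjunction of `SynCat T` composes the term `.eval` with a symmetry, and `eval` composes with
the symmetry once more. The two cancel and leave the class of `.eval`, on which the functor
computes. -/
theorem synFunctor_eval (a b : SynCat T) : G.synFunctor.map (eval a b) =
    eval (G.synFunctor.obj a) (G.synFunctor.obj b) := by
  have h : eval a b = SynCat.ev a b := SymmetricCategory.symmetry_assoc _ _ _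
  rw [h]
  rfl

end Interpretation

end Closed

/-! ### Points `I ⟶ A` and partial evaluation in a monoidal category. -/

section Points

variable {D : Type u₁} [Category.{v₁} D] [MonoidalCategory D]

/-- The tensor product of two points, as a point. -/
def pairPoint {A B : D} (a : 𝟙_ D ⟶ A) (b : 𝟙_ D ⟶ B) : 𝟙_ D ⟶ A ⊗ B :=
  (λ_ (𝟙_ D)).inv ≫ (a ⊗ₘ b)

/-- The partial evaluation of a morphism at a point. -/
def evalPoint {A U V : D} (a : 𝟙_ D ⟶ A) (φ : A ⊗ U ⟶ V) : U ⟶ V :=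
  (λ_ U).inv ≫ a ▷ U ≫ φ

theorem pairPoint_comp {A B A' B' : D} (a : 𝟙_ D ⟶ A) (b : 𝟙_ D ⟶ B) (f : A ⟶ A') (g : B ⟶ B') :
    pairPoint a b ≫ (f ⊗ₘ g) = pairPoint (a ≫ f) (b ≫ g) := by
  simp [pairPoint]

theorem pairPoint_whiskerLeft {A B B' : D} (a : 𝟙_ D ⟶ A) (b : 𝟙_ D ⟶ B) (g : B ⟶ B') :
    pairPoint a b ≫ A ◁ g = pairPoint a (b ≫ g) := by
  rw [← id_tensorHom, pairPoint_comp, Category.comp_id]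

theorem pairPoint_id {B : D} (b : 𝟙_ D ⟶ B) : pairPoint (𝟙 _) b ≫ (λ_ B).hom = b := by
  simp [pairPoint]

theorem pairPoint_id_right {A : D} (a : 𝟙_ D ⟶ A) : pairPoint a (𝟙 _) ≫ (ρ_ A).hom = a := by
  simp [pairPoint, unitors_inv_equal]

theorem pairPoint_assoc {A B C : D} (a : 𝟙_ D ⟶ A) (b : 𝟙_ D ⟶ B) (c : 𝟙_ D ⟶ C) :
    pairPoint (pairPoint a b) c ≫ (α_ A B C).hom = pairPoint a (pairPoint b c) := by
  have h : ((λ_ (𝟙_ D)).inv ≫ (a ⊗ₘ b) ⊗ₘ c) = (λ_ (𝟙_ D)).inv ▷ _ ≫ ((a ⊗ₘ b) ⊗ₘ c) := by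
    rw [← tensorHom_id, tensorHom_comp_tensorHom, Category.id_comp]
  have h' : (a ⊗ₘ (λ_ (𝟙_ D)).inv ≫ (b ⊗ₘ c)) = _ ◁ (λ_ (𝟙_ D)).inv ≫ (a ⊗ₘ (b ⊗ₘ c)) := by
    rw [← id_tensorHom, tensorHom_comp_tensorHom, Category.id_comp]
  simp only [pairPoint, h, h', Category.assoc, associator_naturality]
  monoidal

/-- Naturality moves the symmetry to `I ⊗ I`, where it is the identity. This is the reason why the
order of the entries of a list does not matter. -/
theorem pairPoint_braiding [SymmetricCategory D] {A B : D} (a : 𝟙_ D ⟶ A) (b : 𝟙_ D ⟶ B) :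
    pairPoint a b ≫ (β_ A B).hom = pairPoint b a := by
  rw [pairPoint, pairPoint, Category.assoc, BraidedCategory.braiding_naturality]
  simp [unitors_inv_equal]

theorem evalPoint_id {U V : D} (f : U ⟶ V) : evalPoint (𝟙 _) ((λ_ U).hom ≫ f) = f := by
  simp [evalPoint]

/-- Reindexing the morphism is pushing the point forward. It reduces invariance under permutations
to a statement about points alone. -/
theorem evalPoint_comp_left {A B U V : D} (a : 𝟙_ D ⟶ A) (m : A ⟶ B) (φ : B ⊗ U ⟶ V) :
    evalPoint a (m ▷ U ≫ φ) = evalPoint (a ≫ m) φ := by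
  simp [evalPoint]

/-- The interchange law: the point `b` may be inserted before `φ` is applied instead of after. The
left-hand side has the shape of a composite of pairs, with the later factor first. -/
theorem evalPoint_comp {A B U V W : D} (a : 𝟙_ D ⟶ A) (φ : A ⊗ U ⟶ V) (b : 𝟙_ D ⟶ B)
    (ψ : B ⊗ V ⟶ W) : evalPoint (pairPoint b a) ((α_ B A U).hom ≫ B ◁ φ ≫ ψ) =
      evalPoint a φ ≫ evalPoint b ψ := by
  have h : ((λ_ U).inv ≫ a ▷ U ≫ φ) ≫ (λ_ V).inv ≫ b ▷ V =
      (λ_ U).inv ≫ b ▷ U ≫ B ◁ ((λ_ U).inv ≫ a ▷ U ≫ φ) := by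
    rw [leftUnitor_inv_naturality_assoc, whisker_exchange]
  simp only [Category.assoc] at h
  simp only [evalPoint, pairPoint, Category.assoc, reassoc_of% h]
  rw [MonoidalCategory.tensorHom_def]
  monoidal

/-- By naturality the two points pass through `tensorμ`; what remains is `tensorμ` at two copies of
`I`, which consists of unitors. -/
theorem evalPoint_tensor [SymmetricCategory D] {A A' U V U' V' : D} (a : 𝟙_ D ⟶ A)
    (φ : A ⊗ U ⟶ V) (a' : 𝟙_ D ⟶ A') (φ' : A' ⊗ U' ⟶ V') :
    evalPoint (pairPoint a a') (tensorμ A A' U U' ≫ (φ ⊗ₘ φ')) =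
      evalPoint a φ ⊗ₘ evalPoint a' φ' := by
  have h' : (λ_ (U ⊗ U')).inv ≫ (λ_ (𝟙_ D)).inv ▷ (U ⊗ U') ≫
      tensorμ (𝟙_ D) (𝟙_ D) U U' = ((λ_ U).inv ⊗ₘ (λ_ U').inv) := by
    rw [Iso.inv_comp_eq, tensor_left_unitality]
    simp
  simp only [evalPoint, pairPoint, comp_whiskerRight, Category.assoc]
  rw [tensorμ_natural_left_assoc, reassoc_of% h']
  simp only [tensorHom_comp_tensorHom]

end Points

/-! ### The functor on pairs `(Γ, φ)` determined by a choice of points. -/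

section

variable {D : Type u₁} [Category.{v₁} D] [MonoidalCategory D] [SymmetricCategory D]
  [MonoidalClosed D] {T : Theory.{u}} (G : Interpretation T D) {O : Type u} {t : O → SynCat T}
  (p : ∀ α, 𝟙_ D ⟶ G.synFunctor.obj (t α))

namespace Interpretation

/-- The tensor product of two points of objects in the image of the functor. -/
def pair {A B : SynCat T} (a : 𝟙_ D ⟶ G.synFunctor.obj A) (b : 𝟙_ D ⟶ G.synFunctor.obj B) :
    𝟙_ D ⟶ G.synFunctor.obj (A ⊗ B) := pairPoint a b

section

variable {A B C A' B' : SynCat T} (a : 𝟙_ D ⟶ G.synFunctor.obj A)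
  (b : 𝟙_ D ⟶ G.synFunctor.obj B) (c : 𝟙_ D ⟶ G.synFunctor.obj C)

theorem pair_tensor (f : A ⟶ A') (g : B ⟶ B') : G.pair a b ≫ G.synFunctor.map (f ⊗ₘ g) =
    G.pair (a ≫ G.synFunctor.map f) (b ≫ G.synFunctor.map g) := by
  rw [synFunctor_tensor]
  exact pairPoint_comp _ _ _ _

theorem pair_whiskerLeft (g : B ⟶ B') : G.pair a b ≫ G.synFunctor.map (A ◁ g) =
    G.pair a (b ≫ G.synFunctor.map g) := by
  rw [synFunctor_whiskerLeft]
  exact pairPoint_whiskerLeft _ _ _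

theorem pair_leftUnitor : G.pair (A := 𝟙_ (SynCat T)) (𝟙 (𝟙_ D)) b ≫
    G.synFunctor.map (λ_ B).hom = b := pairPoint_id b

theorem pair_rightUnitor : G.pair (B := 𝟙_ (SynCat T)) a (𝟙 (𝟙_ D)) ≫
    G.synFunctor.map (ρ_ A).hom = a := pairPoint_id_right a

theorem pair_associator : G.pair (G.pair a b) c ≫ G.synFunctor.map (α_ A B C).hom =
    G.pair a (G.pair b c) := pairPoint_assoc a b c

theorem pair_braiding : G.pair a b ≫ G.synFunctor.map (β_ A B).hom = G.pair b a :=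
  pairPoint_braiding a b

end

/-- The tensor product of the points attached to the entries of a list, bracketed to the right. -/
def rightPoint : ∀ Γ : List O, 𝟙_ D ⟶ G.synFunctor.obj (rightTensor t Γ)
  | [] => 𝟙 (𝟙_ D)
  | α :: Γ => G.pair (p α) (rightPoint Γ)

/-- The tensor product of the points attached to the entries of a list. -/
def listPoint (Γ : List O) : 𝟙_ D ⟶ G.synFunctor.obj (listTensor t Γ) :=
  G.rightPoint p Γ ≫ G.synFunctor.map (toRight t Γ).inv

theorem listPoint_nil : G.listPoint p [] = 𝟙 (𝟙_ D) := Category.comp_id _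

/-- The right-bracketed product of a singleton is `t α ⊗ I`, and `toRight` is there the inverse
right unitor. -/
theorem listPoint_singleton (α : O) : G.listPoint p [α] = p α := G.pair_rightUnitor (p α)

/-- With right bracketing, concatenation is a recursion on the first list, and each step is one use
of `pair_associator`. -/
theorem rightPoint_append (Γ Δ : List O) : G.rightPoint p (Γ ++ Δ) =
    G.pair (G.rightPoint p Γ) (G.rightPoint p Δ) ≫
      G.synFunctor.map (rightAppend t Γ Δ).hom := by
  induction Γ with
  | nil => exact (G.pair_leftUnitor _).symm
  | cons α Γ ih =>
    have h : (rightAppend t (α :: Γ) Δ).hom =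
        (α_ (t α) (rightTensor t Γ) (rightTensor t Δ)).hom ≫ t α ◁ (rightAppend t Γ Δ).hom := rfl
    refine Eq.trans ?_ (congrArg (G.pair (G.pair (p α) (G.rightPoint p Γ)) (G.rightPoint p Δ) ≫
      G.synFunctor.map ·) h).symm
    refine (congrArg (G.pair (p α)) ih).trans ?_
    rw [← pair_whiskerLeft, ← pair_associator, Category.assoc, ← G.synFunctor.map_comp]
    rfl

/-- Transfers `rightPoint_append` to the left bracketing: `appendIso` is `rightAppend` conjugated by
`toRight`. -/
theorem listPoint_append (Γ Δ : List O) : G.listPoint p (Γ ++ Δ) =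
    G.pair (G.listPoint p Γ) (G.listPoint p Δ) ≫
      G.synFunctor.map (appendIso t Γ Δ).hom := by
  have e (Γ : List O) : G.rightPoint p Γ =
      G.listPoint p Γ ≫ G.synFunctor.map (toRight t Γ).hom := by
    rw [listPoint, Category.assoc, ← G.synFunctor.map_comp, Iso.inv_hom_id, G.synFunctor.map_id,
      Category.comp_id]
  rw [listPoint, rightPoint_append, e Γ, e Δ, ← pair_tensor]
  simp only [Category.assoc, ← G.synFunctor.map_comp]
  rfl

theorem listPoint_append_inv (Γ Δ : List O) : G.listPoint p (Γ ++ Δ) ≫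
      G.synFunctor.map (appendIso t Γ Δ).inv = G.pair (G.listPoint p Γ) (G.listPoint p Δ) := by
  rw [listPoint_append, Category.assoc, ← G.synFunctor.map_comp, Iso.hom_inv_id,
    G.synFunctor.map_id, Category.comp_id]

/-- Induction on how the permutation map is built. Juxtaposition reduces to multiplicativity of the
points, and a block swap to the invariance of a pair of points under the symmetry. -/
theorem listPoint_isPermMap {Γ Δ : List O} {σ : Fin Δ.length ≃ Fin Γ.length}
    {m : listTensor t Γ ⟶ listTensor t Δ} (h : IsPermMap t σ m) :
    G.listPoint p Γ ≫ G.synFunctor.map m = G.listPoint p Δ := by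
  induction h with
  | id Γ => rw [G.synFunctor.map_id, Category.comp_id]
  | comp _ _ ih ih' => rw [G.synFunctor.map_comp, ← Category.assoc, ih, ih']
  | append _ _ ih ih' =>
    rw [G.synFunctor.map_comp, ← Category.assoc, listPoint_append_inv, G.synFunctor.map_comp,
      listPoint_append, ← ih, ← ih', ← pair_tensor, Category.assoc]
  | swap Γ Δ =>
    rw [G.synFunctor.map_comp, ← Category.assoc, listPoint_append_inv, G.synFunctor.map_comp,
      listPoint_append, ← G.pair_braiding (G.listPoint p Γ), Category.assoc]

/-- The partial evaluation at a point of a morphism in the image of the functor. -/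
def evalAt {A U V : SynCat T} (a : 𝟙_ D ⟶ G.synFunctor.obj A) (φ : A ⊗ U ⟶ V) :
    G.synFunctor.obj U ⟶ G.synFunctor.obj V := evalPoint a (G.synFunctor.map φ)

theorem evalAt_comp_left {A B U V : SynCat T} (a : 𝟙_ D ⟶ G.synFunctor.obj A) (m : A ⟶ B)
    (φ : B ⊗ U ⟶ V) : G.evalAt a (m ▷ U ≫ φ) = G.evalAt (a ≫ G.synFunctor.map m) φ := by
  rw [evalAt, G.synFunctor.map_comp, synFunctor_whiskerRight]
  exact evalPoint_comp_left _ _ _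

theorem evalAt_leftUnitor {U V : SynCat T} (f : U ⟶ V) :
    G.evalAt (A := 𝟙_ (SynCat T)) (𝟙 (𝟙_ D)) ((λ_ U).hom ≫ f) = G.synFunctor.map f := by
  exact (congrArg (evalPoint (𝟙 (𝟙_ D))) (G.synFunctor.map_comp _ _)).trans (evalPoint_id _)

theorem evalAt_comp {A B U V W : SynCat T} (a : 𝟙_ D ⟶ G.synFunctor.obj A) (φ : A ⊗ U ⟶ V)
    (b : 𝟙_ D ⟶ G.synFunctor.obj B) (ψ : B ⊗ V ⟶ W) :
    G.evalAt (G.pair b a) ((α_ B A U).hom ≫ B ◁ φ ≫ ψ) = G.evalAt a φ ≫ G.evalAt b ψ := by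
  rw [evalAt, G.synFunctor.map_comp, G.synFunctor.map_comp, synFunctor_whiskerLeft]
  exact evalPoint_comp _ _ _ _

theorem synFunctor_tensorμ (A B U V : SynCat T) : G.synFunctor.map (tensorμ A B U V) =
    tensorμ (G.synFunctor.obj A) (G.synFunctor.obj B) (G.synFunctor.obj U)
      (G.synFunctor.obj V) := by
  simp only [tensorμ, Functor.map_comp, synFunctor_whiskerLeft, synFunctor_whiskerRight]
  rfl

theorem evalAt_tensor {A U V A' U' V' : SynCat T} (a : 𝟙_ D ⟶ G.synFunctor.obj A)
    (φ : A ⊗ U ⟶ V) (a' : 𝟙_ D ⟶ G.synFunctor.obj A') (φ' : A' ⊗ U' ⟶ V') :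
    G.evalAt (G.pair a a') (tensorμ A A' U U' ≫ (φ ⊗ₘ φ')) = G.evalAt a φ ⊗ₘ G.evalAt a' φ' := by
  rw [evalAt, G.synFunctor.map_comp, synFunctor_tensorμ, synFunctor_tensor]
  exact evalPoint_tensor _ _ _ _

/-- The functor on pairs `(Γ, φ)` which evaluates `φ` at the point attached to `Γ`. -/
def listFunctor : ListCat t ⥤ D where
  obj U := G.synFunctor.obj U.obj
  map {U V} f := G.evalAt (G.listPoint p (ListHom.list f)) (ListHom.map f)
  map_id U := by
    refine Eq.trans ?_ (G.synFunctor.map_id U.obj)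
    -- The identity is the empty list with `λ`; the trailing identity is inserted to match
    -- `evalAt_leftUnitor`.
    exact (congrArg₂ G.evalAt (G.listPoint_nil p) (Category.comp_id _).symm).trans
      (G.evalAt_leftUnitor _)
  map_comp {U V W} f g := by
    -- The composite begins with the inverse of `appendIso`. Pushed onto the point of the
    -- concatenated list, it splits that point into a pair.
    refine (G.evalAt_comp_left _ _ _).trans ?_
    exact (congrArg (G.evalAt · _) (G.listPoint_append_inv p _ _)).trans (G.evalAt_comp _ _ _ _)

/-- A generating step precomposes `φ` with a permutation map, which amounts to pushing the point
along that map, and `listPoint_isPermMap` says where it lands. -/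
theorem listFunctor_permRel {U V : ListCat t} (f g : U ⟶ V) (h : permRel t f g) :
    (G.listFunctor p).map f = (G.listFunctor p).map g := by
  induction h with
  | rel _ _ h =>
    obtain ⟨σ, m, h, φ⟩ := h
    refine Eq.trans ?_ (G.evalAt_comp_left _ _ _).symm
    exact congrArg (G.evalAt · φ) (G.listPoint_isPermMap p h).symm
  | refl => rfl
  | symm _ _ _ ih => exact ih.symm
  | trans _ _ _ _ _ ih ih' => exact ih.trans ih'

/-- The functor on classes of pairs `(Γ, φ)` which evaluates `φ` at the point attached to `Γ`. -/
def quotFunctor : QuotCat t ⥤ D :=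
  CategoryTheory.Quotient.lift (permRel t) (G.listFunctor p)
    (fun _ _ f g h => G.listFunctor_permRel p f g h)

/-- The point of the empty list is the identity of `I`, so nothing is evaluated. Every structure map
that comes from the free category is thereby handled. -/
theorem quotFunctor_incl {U V : SynCat T} (f : U ⟶ V) :
    (G.quotFunctor p).map (QuotCat.incl f) = G.synFunctor.map f := by
  refine Eq.trans ?_ (G.evalAt_leftUnitor f)
  exact congrArg (G.evalAt · _) (G.listPoint_nil p)

theorem quotFunctor_tensor {U V U' V' : QuotCat t} (f : U ⟶ V) (f' : U' ⟶ V') :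
    (G.quotFunctor p).map (f ⊗ₘ f') =
      (G.quotFunctor p).map f ⊗ₘ (G.quotFunctor p).map f' := by
  obtain ⟨f, rfl⟩ := QuotCat.exists_cls f
  obtain ⟨f', rfl⟩ := QuotCat.exists_cls f'
  refine (G.evalAt_comp_left _ _ _).trans ?_
  refine (congrArg (G.evalAt · _) (G.listPoint_append_inv p _ _)).trans ?_
  exact G.evalAt_tensor _ _ _ _

end Interpretation

end

/-! ### Universal characterisation of `⊸` and `η`, and names of morphisms. -/

section Closed

variable {D : Type u₁} [Category.{v₁} D] [MonoidalCategory D] [SymmetricCategory D]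
  [MonoidalClosed D]

/-- Together with `eq_coeval`, this makes preservation of `⊸` and `η` a consequence of preservation
of `⊗` and `ε`: apply the functor to the defining equation. -/
theorem eq_lolliMap {a b c d : D} {f : a ⟶ b} {g : c ⟶ d} {h : lolli b c ⟶ lolli a d}
    (e : h ▷ a ≫ eval a d = lolli b c ◁ f ≫ eval b c ≫ g) : h = lolliMap f g :=
  eval_ext (e.trans (lolliMap_eval f g).symm)

theorem eq_coeval {a b : D} {h : a ⟶ lolli b (a ⊗ b)}
    (e : h ▷ b ≫ eval b (a ⊗ b) = 𝟙 (a ⊗ b)) : h = coeval a b :=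
  eval_ext (e.trans (coeval_eval a b).symm)

/-- The point of the internal hom given by a morphism. -/
def name {a b : D} (f : a ⟶ b) : 𝟙_ D ⟶ lolli a b :=
  coeval (𝟙_ D) a ≫ lolliMap (𝟙 a) ((λ_ a).hom ≫ f)

theorem name_eval {a b : D} (f : a ⟶ b) : name f ▷ a ≫ eval a b = (λ_ a).hom ≫ f := by
  rw [name, comp_whiskerRight, Category.assoc, lolliMap_id_eval, coeval_eval_assoc]

/-- The reason why the functor built from `G` sends `[α]` to `G α`. -/
theorem evalPoint_name {a b : D} (f : a ⟶ b) : evalPoint (name f) (eval a b) = f := by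
  rw [evalPoint, name_eval, Iso.inv_hom_id_assoc]

end Closed

/-! ### The term constructors for `⊸`, `ε` and `η` agree with the closed structure of `SynCat`. -/

namespace SynCat

variable {T : Theory.{u}}

theorem eval_eq (a b : Ty T.X) : cls (.eval a b) = eval (⟨a⟩ : SynCat T) ⟨b⟩ :=
  (SymmetricCategory.symmetry_assoc (C := SynCat T) _ _ _).symm

theorem coeval_eq (a b : Ty T.X) : cls (.coeval a b) = coeval (⟨a⟩ : SynCat T) ⟨b⟩ := by
  refine eq_coeval ?_
  rw [← eval_eq]
  exact triangle_left (T := T) ⟨a⟩ ⟨b⟩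

/-- `lolliMap` is defined by way of the adjunction, so agreement with the constructor is not
definitional. The congruence gives naturality and dinaturality of `ε` separately, and the proof
combines them into the characterising equation. -/
theorem lolli_eq {a b c d : Ty T.X} (f : Term T.toSignature a b) (g : Term T.toSignature c d) :
    cls (.lolli f g) = lolliMap (cls f) (cls g) := by
  refine eq_lolliMap ?_
  rw [← eval_eq, ← eval_eq]
  -- Factoring through `b ⊸ d` separates the covariant argument from the contravariant one.
  have h1 : cls (.lolli f g) = cls (.lolli (.id b) g) ≫ cls (.lolli f (.id d)) :=
    (sound (.lolli_congr (.symm (.comp_id f)) (.symm (.comp_id g)))).trans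
      (sound (.lolli_comp f (.id b) g (.id d)))
  have h2 : cls (.lolli f (.id d)) ▷ (⟨a⟩ : SynCat T) ≫ cls (.eval a d) =
      (⟨.lolli b d⟩ : SynCat T) ◁ cls f ≫ cls (.eval b d) := sound (.eval_dinaturality f d)
  have h3 : cls (.lolli (.id b) g) ▷ (⟨b⟩ : SynCat T) ≫ cls (.eval b d) =
      cls (.eval b c) ≫ cls g := sound (.eval_naturality b g)
  refine (congrArg (· ▷ (⟨a⟩ : SynCat T) ≫ cls (.eval a d)) h1).trans ?_
  refine (congrArg (· ≫ cls (.eval a d)) (comp_whiskerRight _ _ _)).trans ?_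
  refine (Category.assoc _ _ _).trans ((congrArg (_ ≫ ·) h2).trans ?_)
  refine (whisker_exchange_assoc _ _ _).symm.trans ?_
  exact congrArg (_ ≫ ·) h3

end SynCat

/-! ### Decomposition of morphisms of the quotient, and its closed structure on embedded maps. -/

namespace QuotCat

open ListHom

section

variable {K : Type u₁} [Category.{v₁} K] [MonoidalCategory K] [SymmetricCategory K] {O : Type u}
  {t : O → K}

/-- The only symmetry inside this `tensorμ` exchanges two copies of `I`; it is a composite of
unitors, so coherence for monoidal categories applies. -/
theorem tensorμ_unit_unit (A U : K) : tensorμ A (𝟙_ K) (𝟙_ K) U ≫ ((ρ_ A).hom ⊗ₘ (λ_ U).hom) =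
    (ρ_ A).hom ▷ (𝟙_ K ⊗ U) ≫ A ◁ (λ_ U).hom := by
  rw [tensorμ, braiding_tensorUnit_left, MonoidalCategory.tensorHom_def]
  monoidal

theorem shuffle_unit (A U : K) :
    (shuffle A (𝟙_ K) U).hom ≫ (λ_ (A ⊗ U)).hom = A ◁ (λ_ U).hom := by
  simp only [shuffle, Iso.trans_hom, Iso.symm_hom, whiskerRightIso_hom, braiding_tensorUnit_right]
  monoidal

/-- The point of the quotient given by an object isomorphic to the tensor product of a list. -/
def point {A : K} {Γ : List O} (e : A ≅ listTensor t Γ) : of t (𝟙_ K) ⟶ of t A :=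
  cls (ofIso e (ρ_ A).hom)

theorem point_whiskerRight {A U V : K} {Γ : List O} (e : A ≅ listTensor t Γ) (φ : A ⊗ U ⟶ V) :
    point e ▷ of t U ≫ incl φ = incl (λ_ U).hom ≫ cls (ofIso e φ) := by
  have h0 : 𝟙 (of t U) = cls (ofIso (nilIso t) (λ_ U).hom) := congrArg cls (ListHom.id_eq U)
  refine (congrArg (fun z => tensor (point e) z ≫ incl φ) h0).trans ?_
  refine (congrArg (· ≫ incl φ) (tensor_cls_cls _ _ _ _)).trans ?_
  refine (cls_comp_incl _ _ _).trans (Eq.trans ?_ (incl_comp_cls _ _ _).symm)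
  rw [← cls_canon (Canon.of_cast (List.append_nil Γ) (cat_nil e)), tensorμ_unit_unit,
    Category.assoc]

/-- Separates the two components of a pair: the list enters only through a point of `A`, and `φ`
only through the embedding of `K`. Partial evaluation at a point thus already describes every
morphism inside the quotient. -/
theorem cls_eq_point {A U V : K} {Γ : List O} (e : A ≅ listTensor t Γ) (φ : A ⊗ U ⟶ V) :
    cls (ofIso e φ) = incl (λ_ U).inv ≫ point e ▷ of t U ≫ incl φ := by
  refine Eq.trans ?_ (congrArg (incl (λ_ U).inv ≫ ·) (point_whiskerRight e φ)).symm
  refine Eq.trans ?_ (Category.assoc _ _ _)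
  refine Eq.trans ?_ (congrArg (· ≫ _) (incl_comp_incl _ _).symm)
  rw [Iso.inv_hom_id, incl_id, Category.id_comp]

/-- Composition puts the list of the later factor first, so the factor carrying `Δ` is applied
first. It merely adjoins `ty Δ` to `U`, and the second factor does the rest. -/
theorem cls_append {U V : K} (Γ Δ : List O) (φ : listTensor t (Γ ++ Δ) ⊗ U ⟶ V) :
    cls ⟨Γ ++ Δ, φ⟩ = cls ⟨Δ, 𝟙 (listTensor t Δ ⊗ U)⟩ ≫
      cls ⟨Γ, (α_ _ _ _).inv ≫ (appendIso t Γ Δ).hom ▷ U ≫ φ⟩ := by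
  refine congrArg (fun z => cls (ListHom.mk (Γ ++ Δ) z)) ?_
  change φ = (appendIso t Γ Δ).inv ▷ U ≫ (α_ _ _ _).hom ≫ _ ◁ 𝟙 (listTensor t Δ ⊗ U) ≫ _
  simp

end

section

variable {K : Type u₁} [Category.{v₁} K] [MonoidalCategory K] [SymmetricCategory K]
  [MonoidalClosed K] {O : Type u} {t : O → K}

theorem curry_shuffle_unit (A B : K) :
    MonoidalClosed.curry ((shuffle A (𝟙_ K) (lolli A B)).hom ≫ (λ_ (A ⊗ lolli A B)).hom ≫
      MonoidalClosed.uncurry (𝟙 (lolli A B))) = (λ_ (lolli A B)).hom := by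
  have h := shuffle_unit A (lolli A B)
  rw [reassoc_of% h, MonoidalClosed.curry_natural_left, MonoidalClosed.curry_uncurry,
    Category.comp_id]

/-- The bijections of the quotient are those of `K` up to `shuffle`, which for the empty list
reduces to unitors. Hence the transpose of the embedded evaluation is an identity. -/
theorem incl_eval (A B : K) : (incl (eval A B) : of t _ ⟶ of t _) = eval (of t A) (of t B) := by
  have h : (ihom.ev (of t A)).app (of t B) = incl ((ihom.ev A).app B) := by
    refine (homEquiv (of t A) (of t (lolli A B)) (of t B)).injective ?_
    -- The counit of the adjunction is by construction the inverse transpose of the identity.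
    refine ((homEquiv (of t A) (of t (lolli A B)) (of t B)).apply_symm_apply (𝟙 _)).trans ?_
    refine Eq.trans ?_ (congrArg _ (congrArg cls (incl_eq _).symm))
    refine Eq.trans ?_ (homEquiv_cls _ _).symm
    refine (congrArg cls (ListHom.id_eq (lolli A B))).trans ?_
    refine congrArg (fun z => cls (ofIso (nilIso t) z)) ?_
    refine (curry_shuffle_unit A B).symm.trans ?_
    rw [MonoidalClosed.uncurry_id_eq_ev]
    rfl
  refine Eq.trans ?_ (congrArg ((β_ (of t (lolli A B)) (of t A)).hom ≫ ·) h).symm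
  exact (incl_comp_incl _ _).symm

/-- The image of `lolliMap_eval` under the embedding is the characterising equation in the quotient,
since `ε` and whiskering are preserved. `incl_coeval` follows in the same way. -/
theorem incl_lolliMap {A B C E : K} (f : A ⟶ B) (g : C ⟶ E) :
    incl (lolliMap f g) = lolliMap (incl f : of t A ⟶ of t B) (incl g : of t C ⟶ of t E) := by
  refine eq_lolliMap (D := QuotCat t) (a := of t A) (b := of t B) (c := of t C) (d := of t E) ?_
  rw [← incl_eval, ← incl_eval]
  have h := congrArg (incl (t := t)) (lolliMap_eval f g)
  rw [← incl_comp_incl, ← incl_comp_incl, ← incl_comp_incl] at h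
  refine Eq.trans (congrArg (· ≫ _) (incl_tensor_id _ _)) (h.trans ?_)
  exact congrArg (· ≫ _) (id_tensor_incl f (of t (lolli B C))).symm

theorem incl_coeval (A B : K) : (incl (coeval A B) : of t _ ⟶ of t _) = coeval (of t A) (of t B) := by
  refine eq_coeval (D := QuotCat t) (a := of t A) (b := of t B) ?_
  have h := congrArg (incl (t := t)) (coeval_eval A B)
  rw [← incl_comp_incl, incl_eval, incl_id] at h
  exact Eq.trans (congrArg (· ≫ _) (incl_tensor_id _ _)) h

end

end QuotCat

/-- The ground terms and the structure maps generate the category of derived terms under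
composition, tensor product and internal hom. -/
theorem SynCat.hom_induction {T : Theory.{u}} {Q : ∀ {U V : SynCat T}, (U ⟶ V) → Prop}
    (op : ∀ f : T.Op, Q (SynCat.cls (.op f)))
    (id : ∀ U : SynCat T, Q (𝟙 U))
    (comp : ∀ {U V W : SynCat T} (f : U ⟶ V) (g : V ⟶ W), Q f → Q g → Q (f ≫ g))
    (tensor : ∀ {U V U' V' : SynCat T} (f : U ⟶ V) (g : U' ⟶ V'), Q f → Q g → Q (f ⊗ₘ g))
    (lolliMap : ∀ {U V U' V' : SynCat T} (f : U ⟶ V) (g : U' ⟶ V'), Q f → Q g →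
      Q (lolliMap f g))
    (associator : ∀ U V W : SynCat T, Q (α_ U V W).hom)
    (associator_inv : ∀ U V W : SynCat T, Q (α_ U V W).inv)
    (leftUnitor : ∀ U : SynCat T, Q (λ_ U).hom)
    (leftUnitor_inv : ∀ U : SynCat T, Q (λ_ U).inv)
    (rightUnitor : ∀ U : SynCat T, Q (ρ_ U).hom)
    (rightUnitor_inv : ∀ U : SynCat T, Q (ρ_ U).inv)
    (braiding : ∀ U V : SynCat T, Q (β_ U V).hom)
    (eval : ∀ U V : SynCat T, Q (eval U V))
    (coeval : ∀ U V : SynCat T, Q (coeval U V))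
    {U V : SynCat T} (f : U ⟶ V) : Q f := by
  obtain ⟨p, rfl⟩ := SynCat.cls_surj f
  have key : ∀ {a b : Ty T.X} (p : Term T.toSignature a b), Q (SynCat.cls p) := by
    intro a b p
    induction p with
    | op f => exact op f
    | assoc => exact associator_inv _ _ _
    | assocInv => exact associator _ _ _
    | leftUnit => exact leftUnitor _
    | leftUnitInv => exact leftUnitor_inv _
    | rightUnit => exact rightUnitor _
    | rightUnitInv => exact rightUnitor_inv _
    | symm => exact braiding _ _
    | eval a b => exact SynCat.eval_eq a b ▸ eval _ _
    | coeval a b => exact SynCat.coeval_eq a b ▸ coeval _ _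
    | comp f g ihf ihg => exact comp _ _ ihf ihg
    | id a => exact id _
    | tensor f g ihf ihg => exact tensor _ _ ihf ihg
    | lolli f g ihf ihg => exact SynCat.lolli_eq f g ▸ lolliMap _ _ ihf ihg
  exact key p

/-! ### The morphisms `[α]` generate the classifying category. -/

namespace Signature

variable (S : Signature.{u})

section Generation

open QuotCat

/-- The point of `s α ⊸ t α` represented by the pair `((α), 𝟙)`, up to the unit
isomorphism. -/
def opName (α : S.Op) : 𝟙_ S.CohCat ⟶ QuotCat.of S.opTy (S.opTy α) :=
  point (Γ := [α]) (Iso.refl (S.opTy α))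

/-- Tested against `ε`, the pair `((α), 𝟙)` becomes `((α), ε) = [α]` preceded by a unitor, as does
the name of `[α]`. The explicit `@Eq` fixes a common hom-set, whose target is the internal hom only
after unfolding. -/
theorem opName_eq (α : S.Op) :
    @Eq (𝟙_ S.CohCat ⟶ lolli (S.cohTy (S.src α)) (S.cohTy (S.tgt α)))
      (S.opName α) (name (S.gen α)) := by
  refine eval_ext (D := S.CohCat) (a := S.cohTy (S.src α)) (b := S.cohTy (S.tgt α)) ?_
  rw [name_eval]
  refine (congrArg (_ ≫ ·) (incl_eval _ _).symm).trans ?_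
  refine (point_whiskerRight (t := S.opTy) (Γ := [α]) (Iso.refl (S.opTy α))
    (eval (S.ofTy (S.src α)) (S.ofTy (S.tgt α)))).trans ?_
  refine congrArg (fun z => QuotCat.incl _ ≫ cls (ListHom.mk [α] z)) ?_
  exact (congrArg (· ≫ _) (id_whiskerRight _ _)).trans (Category.id_comp _)

/-- The generating morphisms and the structure maps generate the morphisms of the quotient under
composition, tensor product and internal hom. -/
theorem hom_induction {Q : ∀ {U V : S.CohCat}, (U ⟶ V) → Prop}
    (gen : ∀ α, Q (S.gen α))
    (id : ∀ U : S.CohCat, Q (𝟙 U))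
    (comp : ∀ {U V W : S.CohCat} (f : U ⟶ V) (g : V ⟶ W), Q f → Q g → Q (f ≫ g))
    (tensor : ∀ {U V U' V' : S.CohCat} (f : U ⟶ V) (g : U' ⟶ V'), Q f → Q g → Q (f ⊗ₘ g))
    (lolliMap : ∀ {U V U' V' : S.CohCat} (f : U ⟶ V) (g : U' ⟶ V'), Q f → Q g →
      Q (lolliMap f g))
    (associator : ∀ U V W : S.CohCat, Q (α_ U V W).hom)
    (associator_inv : ∀ U V W : S.CohCat, Q (α_ U V W).inv)
    (leftUnitor : ∀ U : S.CohCat, Q (λ_ U).hom)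
    (leftUnitor_inv : ∀ U : S.CohCat, Q (λ_ U).inv)
    (rightUnitor : ∀ U : S.CohCat, Q (ρ_ U).hom)
    (rightUnitor_inv : ∀ U : S.CohCat, Q (ρ_ U).inv)
    (braiding : ∀ U V : S.CohCat, Q (β_ U V).hom)
    (eval : ∀ U V : S.CohCat, Q (eval U V))
    (coeval : ∀ U V : S.CohCat, Q (coeval U V))
    {U V : S.CohCat} (f : U ⟶ V) : Q f := by
  -- Empty lists: the free category has no ground terms, so structure maps alone generate it, and
  -- the embedding preserves them.
  have hincl : ∀ {a b : FreeCat S.X} (f : a ⟶ b), Q (incl f : of S.opTy a ⟶ of S.opTy b) := by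
    intro a b f
    refine SynCat.hom_induction (T := (emptySignature S.X).free)
      (Q := fun {a b} f => Q (incl f : of S.opTy a ⟶ of S.opTy b))
      (fun f => f.elim) (fun U => ?_) (fun f g hf hg => ?_) (fun f g hf hg => ?_)
      (fun f g hf hg => ?_) (fun U V W => associator (of _ U) (of _ V) (of _ W))
      (fun U V W => associator_inv (of _ U) (of _ V) (of _ W))
      (fun U => leftUnitor _) (fun U => leftUnitor_inv _) (fun U => rightUnitor _)
      (fun U => rightUnitor_inv _) (fun U V => braiding (of _ U) (of _ V)) (fun U V => ?_)
      (fun U V => ?_) f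
    · rw [incl_id]
      exact id _
    · rw [← incl_comp_incl]
      exact comp _ _ hf hg
    · rw [← tensor_incl_incl]
      exact tensor _ _ hf hg
    · rw [incl_lolliMap]
      exact lolliMap _ _ hf hg
    · rw [incl_eval]
      exact eval _ _
    · rw [incl_coeval]
      exact coeval _ _
  have hsingle : ∀ (α : S.Op) {U V : FreeCat S.X} (φ : listTensor S.opTy [α] ⊗ U ⟶ V),
      Q (cls (t := S.opTy) ⟨[α], φ⟩) := by
    intro α U V φ
    have h := cls_eq_point (t := S.opTy) (Γ := [α]) (Iso.refl (S.opTy α)) φ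
    have h' : cls (t := S.opTy) ⟨[α], φ⟩ =
        QuotCat.incl (λ_ U).inv ≫ S.opName α ▷ of S.opTy U ≫ QuotCat.incl φ := by
      refine Eq.trans (congrArg (fun z => cls (ListHom.mk [α] z)) ?_) h
      exact ((congrArg (· ≫ _) (id_whiskerRight _ _)).trans (Category.id_comp _)).symm
    rw [h']
    have hname : Q (S.opName α) := by
      -- This composite is the definition of `name (S.gen α)`, built from `η`, `⊸`, a unitor and
      -- `[α]`.
      have := comp _ _ (coeval (𝟙_ S.CohCat) (S.cohTy (S.src α)))
        (lolliMap _ _ (id (S.cohTy (S.src α))) (comp _ _ (leftUnitor _) (gen α)))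
      exact (S.opName_eq α) ▸ this
    have hw := tensor _ _ hname (id (of S.opTy U))
    rw [tensorHom_id] at hw
    exact comp _ _ (hincl _) (comp _ _ hw (hincl _))
  have hlist : ∀ (Γ : List S.Op) {U V : FreeCat S.X} (φ : listTensor S.opTy Γ ⊗ U ⟶ V),
      Q (cls (t := S.opTy) ⟨Γ, φ⟩) := by
    intro Γ
    induction Γ with
    | nil =>
      intro U V φ
      have h : ListHom.mk [] φ = ListHom.incl S.opTy ((λ_ U).inv ≫ φ) :=
        congrArg (ListHom.mk []) (Iso.hom_inv_id_assoc _ _).symm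
      rw [h]
      exact hincl _
    | cons α Γ ih =>
      intro U V φ
      -- `α :: Γ` is definitionally `[α] ++ Γ`, so one entry is split off.
      have h := cls_append [α] Γ φ
      exact h ▸ comp _ _ (ih _) (hsingle _ _)
  obtain ⟨f, rfl⟩ := exists_cls f
  exact hlist f.list f.map

end Generation

end Signature

/-! ### The bijection between strict functors and interpretations, and its naturality. -/

section Lift

variable {S : Signature.{u}} {D : Type u₁} [Category.{v₁} D] [MonoidalCategory D]
  [SymmetricCategory D] [MonoidalClosed D]

namespace Interpretation

variable (G : Interpretation S.free D)

/-- The interpretation of the ground types, forgetting the ground terms. -/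
def ground : Interpretation (emptySignature S.X).free D where
  obj := G.obj
  op f := f.elim
  sat _ _ h := h.elim

/-- The point of the interpretation of `s α ⊸ t α` given by the interpretation of `α`. -/
def opPoint (α : S.Op) : 𝟙_ D ⟶ G.ground.synFunctor.obj (S.opTy α) := name (G.op α)

/-- The functor determined by an interpretation. -/
def cohFunctor : S.CohCat ⥤ D := G.ground.quotFunctor G.opPoint

/-- The counit of the quotient lies in the image of the free category, where the functor is the
interpretation of terms. -/
theorem cohFunctor_eval (U V : S.CohCat) : G.cohFunctor.map (eval U V) =
    eval (G.cohFunctor.obj U) (G.cohFunctor.obj V) :=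
  (congrArg G.cohFunctor.map (QuotCat.incl_eval U.as.obj V.as.obj).symm).trans
    ((G.ground.quotFunctor_incl G.opPoint _).trans (G.ground.synFunctor_eval _ _))

theorem cohFunctor_tensor {U V U' V' : S.CohCat} (f : U ⟶ V) (g : U' ⟶ V') :
    G.cohFunctor.map (f ⊗ₘ g) = G.cohFunctor.map f ⊗ₘ G.cohFunctor.map g :=
  G.ground.quotFunctor_tensor G.opPoint f g

theorem cohFunctor_whiskerRight {U V : S.CohCat} (f : U ⟶ V) (W : S.CohCat) :
    G.cohFunctor.map (f ▷ W) = G.cohFunctor.map f ▷ G.cohFunctor.obj W :=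
  (G.cohFunctor_tensor f (𝟙 W)).trans
    ((congrArg (_ ⊗ₘ ·) (G.cohFunctor.map_id W)).trans (tensorHom_id _ _))

theorem cohFunctor_whiskerLeft (W : S.CohCat) {U V : S.CohCat} (f : U ⟶ V) :
    G.cohFunctor.map (W ◁ f) = G.cohFunctor.obj W ◁ G.cohFunctor.map f :=
  (G.cohFunctor_tensor (𝟙 W) f).trans
    ((congrArg (· ⊗ₘ _) (G.cohFunctor.map_id W)).trans (id_tensorHom _ _))

/-- Here `f` and `g` may carry nonempty lists, so reduction to the free category is not available.
Instead the functor is applied to `lolliMap_eval`. -/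
theorem cohFunctor_lolliMap {U V U' V' : S.CohCat} (f : U ⟶ V) (g : U' ⟶ V') :
    G.cohFunctor.map (lolliMap f g) = lolliMap (G.cohFunctor.map f) (G.cohFunctor.map g) := by
  refine eq_lolliMap ?_
  have h := congrArg G.cohFunctor.map (lolliMap_eval f g)
  rw [G.cohFunctor.map_comp, G.cohFunctor.map_comp, G.cohFunctor.map_comp,
    cohFunctor_whiskerRight, cohFunctor_whiskerLeft, cohFunctor_eval, cohFunctor_eval] at h
  exact h

theorem cohFunctor_coeval (U V : S.CohCat) : G.cohFunctor.map (coeval U V) =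
    coeval (G.cohFunctor.obj U) (G.cohFunctor.obj V) := by
  refine eq_coeval ?_
  have h := congrArg G.cohFunctor.map (coeval_eval U V)
  rw [G.cohFunctor.map_comp, cohFunctor_whiskerRight, cohFunctor_eval, G.cohFunctor.map_id] at h
  exact h

/-- The strict functor determined by an interpretation. -/
def lift : StrictFunctor S.CohCat D where
  functor := G.cohFunctor
  obj_unit := rfl
  obj_tensor _ _ := rfl
  obj_lolli _ _ := rfl
  map_tensor f g := heq_of_eq (G.cohFunctor_tensor f g)
  map_lolli f g := heq_of_eq (G.cohFunctor_lolliMap f g)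
  -- The associators, unitors and symmetries of the quotient are embedded ones, and interpreting
  -- their terms gives those of `D` by definition.
  map_associator _ _ _ := heq_of_eq (G.ground.quotFunctor_incl G.opPoint _)
  map_leftUnitor _ := heq_of_eq (G.ground.quotFunctor_incl G.opPoint _)
  map_rightUnitor _ := heq_of_eq (G.ground.quotFunctor_incl G.opPoint _)
  map_braiding _ _ := heq_of_eq (G.ground.quotFunctor_incl G.opPoint _)
  map_eval U V := heq_of_eq (G.cohFunctor_eval U V)
  map_coeval U V := heq_of_eq (G.cohFunctor_coeval U V)

/-- For the pair `((α), ε)` the point is `name (G.op α)` and the evaluated map is `ε`, so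
`evalPoint_name` applies. -/
theorem cohFunctor_gen (α : S.Op) : G.cohFunctor.map (S.gen α) = G.op α := by
  refine Eq.trans ?_ (evalPoint_name (G.op α))
  exact congrArg₂ evalPoint (G.ground.listPoint_singleton G.opPoint α)
    (G.ground.synFunctor_eval _ _)

theorem lift_toInterpretation : G.lift.toInterpretation = G := by
  refine Interpretation.ext rfl (heq_of_eq (funext fun α => ?_))
  -- The functor computes on objects to the interpretation of types, so both transports are
  -- identities by definition.
  refine (Category.id_comp _).trans ((Category.comp_id _).trans ?_)
  exact G.cohFunctor_gen α

end Interpretation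

/-- Heterogeneous equality absorbs the transports in the definition of the interpretation. -/
theorem StrictFunctor.toInterpretation_op_heq (F : StrictFunctor S.CohCat D) (α : S.Op) :
    HEq (F.toInterpretation.op α) (F.functor.map (S.gen α)) :=
  (eqToHom_comp_heq _ _).trans (comp_eqToHom_heq _ _)

/-- On objects, a strict functor is determined by its values at ground types. On morphisms,
strictness propagates agreement from the `[α]` to everything they generate. -/
theorem StrictFunctor.toInterpretation_injective :
    Function.Injective (fun F : StrictFunctor S.CohCat D => F.toInterpretation) := by
  intro F F' h
  have e : ∀ U : S.CohCat, F.functor.obj U = F'.functor.obj U := fun U =>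
    (S.obj_cohTy F U.as.obj.ty).trans ((congrArg (fun G : Interpretation S.free D =>
      Ty.interp G.obj U.as.obj.ty) h).trans (S.obj_cohTy F' U.as.obj.ty).symm)
  have hmap : ∀ {U V : S.CohCat} (f : U ⟶ V), HEq (F.functor.map f) (F'.functor.map f) := by
    intro U V f
    refine S.hom_induction (Q := fun f => HEq (F.functor.map f) (F'.functor.map f))
      ?_ ?_ ?_ ?_ ?_ ?_ ?_ ?_ ?_ ?_ ?_ ?_ ?_ ?_ f
    · intro α
      -- The only case of the induction that needs agreement on ground terms; the others use
      -- strictness and agreement on objects.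
      refine (F.toInterpretation_op_heq α).symm.trans (HEq.trans ?_ (F'.toInterpretation_op_heq α))
      dsimp only at h
      rw [h]
    · intro U
      rw [F.functor.map_id, F'.functor.map_id]
      exact heq_id (e U)
    · intro U V W f g hf hg
      rw [F.functor.map_comp, F'.functor.map_comp]
      exact heq_comp (e U) (e V) (e W) hf hg
    · intro U V U' V' f g hf hg
      exact (F.map_tensor f g).trans ((heq_tensor (e _) (e _) (e _) (e _) hf hg).trans
        (F'.map_tensor f g).symm)
    · intro U V U' V' f g hf hg
      exact (F.map_lolli f g).trans ((heq_lolli (e _) (e _) (e _) (e _) hf hg).trans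
        (F'.map_lolli f g).symm)
    · intro U V W
      exact (F.map_associator U V W).trans ((heq_associator (e _) (e _) (e _)).trans
        (F'.map_associator U V W).symm)
    · intro U V W
      -- Strictness is postulated for the forward isomorphisms only; agreement on the inverses
      -- follows from uniqueness of inverses.
      exact heq_inv (F.functor.mapIso (α_ U V W)) (F'.functor.mapIso (α_ U V W)) (e _) (e _)
        ((F.map_associator U V W).trans ((heq_associator (e _) (e _) (e _)).trans
          (F'.map_associator U V W).symm))
    · intro U
      exact (F.map_leftUnitor U).trans ((heq_leftUnitor (e _)).trans (F'.map_leftUnitor U).symm)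
    · intro U
      exact heq_inv (F.functor.mapIso (λ_ U)) (F'.functor.mapIso (λ_ U)) (e _) (e _)
        ((F.map_leftUnitor U).trans ((heq_leftUnitor (e _)).trans (F'.map_leftUnitor U).symm))
    · intro U
      exact (F.map_rightUnitor U).trans ((heq_rightUnitor (e _)).trans
        (F'.map_rightUnitor U).symm)
    · intro U
      exact heq_inv (F.functor.mapIso (ρ_ U)) (F'.functor.mapIso (ρ_ U)) (e _) (e _)
        ((F.map_rightUnitor U).trans ((heq_rightUnitor (e _)).trans
          (F'.map_rightUnitor U).symm))
    · intro U V
      exact (F.map_braiding U V).trans ((heq_braiding (e _) (e _)).trans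
        (F'.map_braiding U V).symm)
    · intro U V
      exact (F.map_eval U V).trans ((heq_eval (e _) (e _)).trans (F'.map_eval U V).symm)
    · intro U V
      exact (F.map_coeval U V).trans ((heq_coeval (e _) (e _)).trans (F'.map_coeval U V).symm)
  refine StrictFunctor.ext (CategoryTheory.Functor.hext e fun U V f => hmap f)

/-- For each `α`, both sides are `H (F [α])` up to transport along equalities of objects. -/
theorem StrictFunctor.comp_toInterpretation {D' : Type u₂} [Category.{v₂} D']
    [MonoidalCategory D'] [SymmetricCategory D'] [MonoidalClosed D'] (F : StrictFunctor S.CohCat D)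
    (H : StrictFunctor D D') : (F.comp H).toInterpretation = F.toInterpretation.map H := by
  refine Interpretation.ext rfl (heq_of_eq (funext fun α => ?_))
  refine eq_of_heq ((F.comp H).toInterpretation_op_heq α |>.trans (HEq.symm ?_))
  refine ((eqToHom_comp_heq _ _).trans (comp_eqToHom_heq _ _)).trans ?_
  exact heq_map H.functor (S.obj_cohTy F (S.src α)).symm (S.obj_cohTy F (S.tgt α)).symm
    (F.toInterpretation_op_heq α)

end Lift

end SMC

theorem mainTheorem2 (S : SMC.Signature.{u}) :
    (∀ (D : Type u₁) [Category.{v₁} D] [MonoidalCategory D] [SymmetricCategory D]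
        [MonoidalClosed D],
      Function.Bijective (fun F : SMC.StrictFunctor S.CohCat D => F.toInterpretation)) ∧
    (∀ (D : Type u₁) [Category.{v₁} D] [MonoidalCategory D] [SymmetricCategory D]
        [MonoidalClosed D]
        (D' : Type u₂) [Category.{v₂} D'] [MonoidalCategory D'] [SymmetricCategory D']
        [MonoidalClosed D']
        (H : SMC.StrictFunctor D D') (F : SMC.StrictFunctor S.CohCat D),
      (F.comp H).toInterpretation = F.toInterpretation.map H) :=
  ⟨fun _ _ _ _ _ => ⟨SMC.StrictFunctor.toInterpretation_injective,
    fun G => ⟨G.lift, G.lift_toInterpretation⟩⟩,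
    fun _ _ _ _ _ _ _ _ _ _ H F => F.comp_toInterpretation H⟩
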